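/- For positive integers $n,d$ write $[n]=\{1,\dots,n\}$. A function $f:[n]^d\to\mathbb R$ is unate if for every coordinate $i\in[d]$ it is either nondecreasing in the $i$-th coordinate (along every line parallel to that axis) or nonincreasing in the $i$-th coordinate (along every such line). For $\varepsilon>0$, $f$ is $\varepsilon$-far from unate if at least $\varepsilon n^d$ of its values must be modified to obtain a unate function. A unateness tester (on $[n]^d$, with distance parameter $\varepsilon$) is a randomized algorithm with query access to the values of an unknown $f:[n]^d\to\mathbb R$ that accepts with probability at least $2/3$ if $f$ is unate and rejects with probability at least $2/3$ if $f$ is $\varepsilon$-far from unate. It has one-sided error if it always accepts unate functions. It is nonadaptive if, once its random choices are fixed, its queries do not depend on the answers; an adaptive tester may choose queries depending on the previous answers. It makes at most $q$ queries if it does so on every input and for every outcome of its random choices. Theorem. There is an absolute constant $C>0$ such that for all integers $n,d\ge 1$ and every $\varepsilon\in(0,1/2)$ the following hold. 1. There is a nonadaptive unateness tester with one-sided error for functions $f:[n]^d\to\mathbb R$ with distance parameter $\varepsilon$ that makes at most $C\,\frac d\varepsilon\left(\log\frac d\varepsilon+\log n\right)$ queries. For the hypercube ($n=2$) it makes at most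 $C\,\frac d\varepsilon\log\frac d\varepsilon$ queries. 2. There is an (adaptive) unateness tester with one-sided error for functions $f:[n]^d\to\mathbb R$ with distance parameter $\varepsilon$ that makes at most $C\,\frac{d\log n}{\varepsilon}$ queries. For the hypercube ($n=2$) it makes at most $C\,\frac d\varepsilon$ queries. -/

import Mathlib

namespace PropertyTesting

/-- A deterministic query algorithm with oracle access to a function `f : X → ℝ`: it either halts
and outputs a verdict (`true` is "accept", `false` is "reject"), or queries the value of `f` at a
point and continues in a way that may depend on the answer. -/
inductive QueryAlg (X : Type) : Type
  | output (verdict : Bool) : QueryAlg X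
  | query (x : X) (next : ℝ → QueryAlg X) : QueryAlg X

/-- The verdict of a deterministic query algorithm on the input function `f`. -/
def QueryAlg.run {X : Type} : QueryAlg X → (X → ℝ) → Bool
  | .output v, _ => v
  | .query x next, f => (next (f x)).run f

/-- The sequence of queries (with repetitions) made on the input function `f`. -/
def QueryAlg.queries {X : Type} : QueryAlg X → (X → ℝ) → List X
  | .output _, _ => []
  | .query x next, f => x :: (next (f x)).queries f

/-- A randomized query algorithm: a probability distribution over deterministic ones
(all random choices are drawn in advance). -/
abbrev RandAlg (X : Type) : Type := PMF (QueryAlg X)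

/-- The probability that `A` accepts `f`. -/
noncomputable def acceptProb {X : Type} (A : RandAlg X) (f : X → ℝ) : ENNReal :=
  (A.map fun T => T.run f) true

/-- The probability that `A` rejects `f`. -/
noncomputable def rejectProb {X : Type} (A : RandAlg X) (f : X → ℝ) : ENNReal :=
  (A.map fun T => T.run f) false

/-- `A` makes at most `q` queries: on every input function and for every outcome of
its random choices. -/
def MakesAtMost {X : Type} (A : RandAlg X) (q : ℝ) : Prop :=
  ∀ T ∈ A.support, ∀ f : X → ℝ, ((T.queries f).length : ℝ) ≤ q

/-- `A` is nonadaptive: once its random choices are fixed, its queries do not depend on the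
answers. -/
def IsNonadaptive {X : Type} (A : RandAlg X) : Prop :=
  ∀ T ∈ A.support, ∀ f g : X → ℝ, T.queries f = T.queries g

/-- `f` is `ε`-far from the property `P` : at least an `ε` fraction of the values of `f` must be
modified in order to obtain a function in `P`. -/
def IsFar {X : Type} [Fintype X] (P : Set (X → ℝ)) (ε : ℝ) (f : X → ℝ) : Prop :=
  ∀ g ∈ P, ε * (Fintype.card X : ℝ) ≤ (hammingDist f g : ℝ)

/-- `A` is a tester for the property `P` with distance parameter `ε`. -/
def IsTester {X : Type} [Fintype X] (P : Set (X → ℝ)) (ε : ℝ) (A : RandAlg X) : Prop :=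
  (∀ f ∈ P, 2 / 3 ≤ acceptProb A f) ∧ (∀ f, IsFar P ε f → 2 / 3 ≤ rejectProb A f)

/-- One-sided error: functions that have the property are always accepted. -/
def HasOneSidedError {X : Type} (P : Set (X → ℝ)) (A : RandAlg X) : Prop :=
  ∀ f ∈ P, ∀ T ∈ A.support, T.run f = true

/-- The hypergrid `[n]^d`; the hypercube is the case `n = 2`. -/
abbrev Hypergrid (n d : ℕ) : Type := Fin d → Fin n

/-- The unate functions on `[n]^d`: in every coordinate the function is either nondecreasing
or nonincreasing. -/
def Unate (n d : ℕ) : Set (Hypergrid n d → ℝ) :=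
  {f | ∀ i : Fin d,
    (∀ x : Hypergrid n d, Monotone fun a : Fin n => f (Function.update x i a)) ∨
    (∀ x : Hypergrid n d, Antitone fun a : Fin n => f (Function.update x i a))}

end PropertyTesting

/-!
The proof has three parts.

**Dimension reduction** (`exists_unate_hammingDist_le`). Let `S i` be sets of points such that `f`
is monotone in direction `i` on the lines of that direction once the points of `S i` are deleted,
where the sense of monotonicity may depend on `i`. Then `f` becomes unate after changing
`12 ∑ i, |S i|` values. After reflections all directions are increasing. For a set `F` and a set
`J` of directions, let `upperDist J F` be the distance of `F` to the sets that are closed under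
increasing the coordinates in `J`; it is submodular and `1`-Lipschitz in `F`. Let
`levelVariation J f` be the total variation of `upperDist J` along the superlevel sets of `f`,
taken one point at a time. It vanishes for `J = ∅`. It bounds the distance of `f` to monotone
functions when `J` is everything, because `f` is monotone on the points at which `upperDist` does
not jump. It moves by `O(|S|)` when `f` is changed on `S`, since by submodularity the marginal
value of a point is monotone along a chain. It is the same for `insert r J` and for `J` if `f` is
monotone in direction `r`, since nearest upper sets of the slices can be chosen monotonically.
Replacing `f` by an extension that is monotone in direction `r`, and back, therefore costs
`O(|S r|)`.

**Lines.** On a line, call a point locally bad if it is inverted with a constant fraction of some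
dyadic window around it. Deleting these points makes the function monotone, and a sample
consisting of a random point `x`, a random neighbour of `x` at each dyadic scale and one far point
`z` contains a decrease with probability of the order of the density of the locally bad points
(`le_card_hasDecrease`). Moreover, if `x` and its neighbour `y` form an inverted pair and neither
of them is inverted with many points, then most far points `z` form an increasing pair with `x` or
with `y`. With a maximal inequality, this bounds the number of locally bad points by the number of
all inverted pairs and the number of seeds for which one sample contains both a decrease and an
increase (`card_locallyBad_le`).

**Testers.** Both testers reject only if they have seen an increase and a decrease in the same
direction, so the error is one-sided. The adaptive one performs `O(d / ε)` trials. In a trial it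
samples one line of a random direction, and if the sample is not constant it continues up to the
next nonconstant sample. A trial reads at most two samples on average, and it sees both a decrease and an
increase with probability at least about a quarter of the smaller of their probabilities. Markov's
inequality allows a deterministic cutoff. The nonadaptive one takes `O(d / ε)` line samples, which
are enough if single samples often contain both a decrease and an increase. Otherwise pairs of
uniform points of a line, at two queries each, see decreases and increases often enough; they are
spread over `O(log (d / ε))` levels, where level `r` spends `2 ^ r` pairs on each of
`O(d / (2 ^ r ε))` random directions.
-/

namespace PropertyTesting

/-! ### Variation of a submodular set function along a chain -/

section Variation

variable {α : Type*} [DecidableEq α]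

/-- The total variation of a set function `m` along the chain of sets obtained from `F` by
inserting the elements of a list one after the other. -/
def variation (m : Finset α → ℤ) : Finset α → List α → ℤ
  | _, [] => 0
  | F, v :: L => |m (insert v F) - m F| + variation m (insert v F) L

variable {m : Finset α → ℤ}

lemma variation_congr {m' : Finset α → ℤ} :
    ∀ (L : List α) (F : Finset α),
      (∀ L₁ L₂, L = L₁ ++ L₂ → m (F ∪ L₁.toFinset) = m' (F ∪ L₁.toFinset)) →
      variation m F L = variation m' F L
  | [], _, _ => rfl
  | v :: L, F, h => by
    have h0 : m F = m' F := by simpa using h [] (v :: L) rfl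
    have h1 : m (insert v F) = m' (insert v F) := by
      have := h [v] L rfl
      rwa [show F ∪ [v].toFinset = insert v F by ext; simp] at this
    simp only [variation, h0, h1]
    rw [variation_congr L (insert v F)]
    intro L₁ L₂ e
    have := h (v :: L₁) L₂ (by simp [e])
    rwa [show F ∪ (v :: L₁).toFinset = insert v F ∪ L₁.toFinset by ext; simp] at this

/-- Inserting `v` in front of a list changes the variation by at most the total decrease of the
marginal value of `v`; submodularity makes that marginal value monotone along the chain. -/
lemma abs_variation_insert_sub_le
    (hsub : ∀ F G, m (F ∪ G) + m (F ∩ G) ≤ m F + m G) {v : α} :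
    ∀ (L : List α) (F : Finset α), v ∉ F → v ∉ L →
      |variation m (insert v F) L - variation m F L| ≤
        (m (insert v F) - m F) - (m (insert v (F ∪ L.toFinset)) - m (F ∪ L.toFinset))
  | [], F, _, _ => by simp [variation]
  | x :: L, F, hF, hL => by
    have hx : v ≠ x := fun h => hL (by simp [h])
    have hvL : v ∉ L := fun h => hL (by simp [h])
    have ih := abs_variation_insert_sub_le hsub L (insert x F) (by simp [hx, hF]) hvL
    have hs := hsub (insert v F) (insert x F)
    rw [show insert v F ∪ insert x F = insert x (insert v F) by ext; simp,
      show insert v F ∩ insert x F = F by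
        ext y
        simp only [Finset.mem_inter, Finset.mem_insert]
        constructor
        · rintro ⟨rfl | h, rfl | h'⟩ <;> first | assumption | exact absurd rfl hx
        · tauto] at hs
    rw [show F ∪ (x :: L).toFinset = insert x F ∪ L.toFinset by ext; simp]
    simp only [variation]
    rw [Finset.insert_comm v x] at ih
    have key := abs_abs_sub_abs_le_abs_sub (m (insert x (insert v F)) - m (insert v F))
      (m (insert x F) - m F)
    rw [abs_of_nonpos (a := (m (insert x (insert v F)) - m (insert v F)) -
      (m (insert x F) - m F)) (by linarith)] at key
    rw [abs_le] at ih key ⊢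
    constructor <;> linarith [ih.1, ih.2, key.1, key.2]

/-- Deleting elements from a list changes the variation of a submodular, `1`-Lipschitz set
function by at most `3` per element. -/
lemma abs_variation_sub_le_of_sublist
    (hsub : ∀ F G, m (F ∪ G) + m (F ∩ G) ≤ m F + m G)
    (hlip : ∀ F v, |m (insert v F) - m F| ≤ 1)
    {L' L : List α} (h : List.Sublist L' L) :
    ∀ F : Finset α, L.Nodup → (∀ x ∈ L, x ∉ F) →
      |variation m F L - variation m F L'| ≤ 3 * ((L.length : ℤ) - L'.length) := by
  induction h with
  | slnil => intro F _ _; simp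
  | @cons L' L v _ ih =>
    intro F hL hF
    have hv := List.nodup_cons.1 hL
    have h1 := ih F hv.2 fun x hx => hF x (by simp [hx])
    have h2 := abs_variation_insert_sub_le hsub L F (hF v (by simp)) hv.1
    have h3 := abs_le.1 (hlip F v)
    have h4 := abs_le.1 (hlip (F ∪ L.toFinset) v)
    have h5 := hlip F v
    have h6 := abs_nonneg (m (insert v F) - m F)
    simp only [variation, List.length_cons]
    push_cast
    rw [abs_le] at h1 h2 ⊢
    constructor <;> linarith [h1.1, h1.2, h2.1, h2.2, h3.1, h3.2, h4.1, h4.2]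
  | @cons_cons L' L v _ ih =>
    intro F hL hF
    have hv := List.nodup_cons.1 hL
    have h1 := ih (insert v F) hv.2 fun x hx => by
      simp only [Finset.mem_insert, not_or]
      exact ⟨fun e => hv.1 (e ▸ hx), hF x (by simp [hx])⟩
    simp only [variation, List.length_cons]
    push_cast
    rw [show ∀ a b c : ℤ, a + b - (a + c) = b - c by intros; ring]
    linarith

/-- The variation bounds the number of elements of the list at which `m` changes. -/
lemma exists_jumps (m : Finset α → ℤ) :
    ∀ (L : List α) (F : Finset α), ∃ B : Finset α, (B.card : ℤ) ≤ variation m F L ∧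
      ∀ x ∈ L, x ∉ B → ∃ L₁ L₂, L = L₁ ++ x :: L₂ ∧
        m (insert x (F ∪ L₁.toFinset)) = m (F ∪ L₁.toFinset)
  | [], _ => ⟨∅, by simp [variation], by simp⟩
  | v :: L, F => by
    obtain ⟨B, hB, h⟩ := exists_jumps m L (insert v F)
    have hrec : ∀ x ∈ L, x ∉ B → ∃ L₁ L₂, v :: L = L₁ ++ x :: L₂ ∧
        m (insert x (F ∪ L₁.toFinset)) = m (F ∪ L₁.toFinset) := by
      intro x hx hxB
      obtain ⟨L₁, L₂, e, h2⟩ := h x hx hxB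
      refine ⟨v :: L₁, L₂, by simp [e], ?_⟩
      rwa [show F ∪ (v :: L₁).toFinset = insert v F ∪ L₁.toFinset by ext; simp]
    by_cases hv : m (insert v F) = m F
    · refine ⟨B, ?_, ?_⟩
      · simpa [variation, hv] using hB
      · intro x hx hxB
        rcases List.mem_cons.1 hx with rfl | hx
        · exact ⟨[], L, rfl, by simpa using hv⟩
        · exact hrec x hx hxB
    · refine ⟨insert v B, ?_, ?_⟩
      · have h1 : (1 : ℤ) ≤ |m (insert v F) - m F| := Int.one_le_abs (sub_ne_zero.2 hv)
        have h2 : ((insert v B).card : ℤ) ≤ B.card + 1 := by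
          exact_mod_cast Finset.card_insert_le v B
        simp only [variation]
        linarith
      · intro x hx hxB
        simp only [Finset.mem_insert, not_or] at hxB
        exact hrec x ((List.mem_cons.1 hx).resolve_left hxB.1) hxB.2

end Variation

/-! ### Distance to upper sets -/

section UpperSets

variable {n d : ℕ}

/-- `U` is closed under increasing the coordinates in `J`. -/
def IsUpperOn (J : Finset (Fin d)) (U : Finset (Hypergrid n d)) : Prop :=
  ∀ x ∈ U, ∀ y, x ≤ y → (∀ i, i ∉ J → x i = y i) → y ∈ U

/-- The least number of points in which `F` differs from a set that is closed under increasing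
the coordinates in `J`. -/
noncomputable def upperDist (J : Finset (Fin d)) (F : Finset (Hypergrid n d)) : ℕ :=
  sInf {c | ∃ U, IsUpperOn J U ∧ c = (symmDiff F U).card}

variable {J : Finset (Fin d)}

lemma IsUpperOn.union {U V : Finset (Hypergrid n d)} (hU : IsUpperOn J U) (hV : IsUpperOn J V) :
    IsUpperOn J (U ∪ V) := by
  intro x hx y hxy h
  rcases Finset.mem_union.1 hx with hx | hx
  · exact Finset.mem_union_left _ (hU x hx y hxy h)
  · exact Finset.mem_union_right _ (hV x hx y hxy h)

lemma IsUpperOn.inter {U V : Finset (Hypergrid n d)} (hU : IsUpperOn J U) (hV : IsUpperOn J V) :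
    IsUpperOn J (U ∩ V) := by
  intro x hx y hxy h
  rw [Finset.mem_inter] at hx ⊢
  exact ⟨hU x hx.1 y hxy h, hV x hx.2 y hxy h⟩

lemma upperDist_le {U : Finset (Hypergrid n d)} (hU : IsUpperOn J U) (F : Finset (Hypergrid n d)) :
    upperDist J F ≤ (symmDiff F U).card :=
  Nat.sInf_le ⟨U, hU, rfl⟩

lemma exists_upperDist_eq (J : Finset (Fin d)) (F : Finset (Hypergrid n d)) :
    ∃ U, IsUpperOn J U ∧ upperDist J F = (symmDiff F U).card :=
  Nat.sInf_mem (s := {c | ∃ U, IsUpperOn J U ∧ c = (symmDiff F U).card})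
    ⟨_, ∅, by simp [IsUpperOn], rfl⟩

lemma card_symmDiff_union_add_inter_le {α : Type*} [DecidableEq α] (F G U V : Finset α) :
    (symmDiff (F ∪ G) (U ∪ V)).card + (symmDiff (F ∩ G) (U ∩ V)).card ≤
      (symmDiff F U).card + (symmDiff G V).card := by
  rw [← Finset.card_union_add_card_inter, ← Finset.card_union_add_card_inter (symmDiff F U)]
  refine add_le_add (Finset.card_le_card ?_) (Finset.card_le_card ?_) <;>
  · intro x
    simp only [Finset.mem_union, Finset.mem_inter, Finset.mem_symmDiff]
    tauto

lemma upperDist_submodular (F G : Finset (Hypergrid n d)) :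
    (upperDist J (F ∪ G) : ℤ) + upperDist J (F ∩ G) ≤ upperDist J F + upperDist J G := by
  obtain ⟨U, hU, eU⟩ := exists_upperDist_eq J F
  obtain ⟨V, hV, eV⟩ := exists_upperDist_eq J G
  rw [eU, eV]
  have h1 := upperDist_le (hU.union hV) (F ∪ G)
  have h2 := upperDist_le (hU.inter hV) (F ∩ G)
  have h3 := card_symmDiff_union_add_inter_le F G U V
  omega

lemma card_symmDiff_insert_le {α : Type*} [DecidableEq α] (F U : Finset α) (v : α) :
    (symmDiff (insert v F) U).card ≤ (symmDiff F U).card + 1 ∧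
      (symmDiff F U).card ≤ (symmDiff (insert v F) U).card + 1 := by
  constructor <;>
  · refine le_trans (Finset.card_le_card (t := insert v _) ?_) (Finset.card_insert_le v _)
    intro x
    simp only [Finset.mem_insert, Finset.mem_symmDiff]
    tauto

lemma abs_upperDist_insert_sub_le (F : Finset (Hypergrid n d)) (v : Hypergrid n d) :
    |(upperDist J (insert v F) : ℤ) - upperDist J F| ≤ 1 := by
  obtain ⟨U, hU, eU⟩ := exists_upperDist_eq J F
  obtain ⟨V, hV, eV⟩ := exists_upperDist_eq J (insert v F)
  have h1 := upperDist_le hU (insert v F)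
  have h2 := upperDist_le hV F
  have h3 := (card_symmDiff_insert_le F U v).1
  have h4 := (card_symmDiff_insert_le F V v).2
  rw [abs_le]
  omega

/-- The nearest `J`-upper sets can be chosen monotonically: take those of largest cardinality. -/
lemma exists_monotone_nearest (J : Finset (Fin d)) :
    ∃ U : Finset (Hypergrid n d) → Finset (Hypergrid n d), Monotone U ∧
      ∀ F, IsUpperOn J (U F) ∧ upperDist J F = (symmDiff F (U F)).card := by
  classical
  have hex : ∀ F : Finset (Hypergrid n d), ∃ U,
      (IsUpperOn J U ∧ upperDist J F = (symmDiff F U).card) ∧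
      ∀ V, IsUpperOn J V → upperDist J F = (symmDiff F V).card → V.card ≤ U.card := by
    intro F
    obtain ⟨U, hU, hmax⟩ := Finset.exists_max_image
      (Finset.univ.filter fun U => IsUpperOn J U ∧ upperDist J F = (symmDiff F U).card)
      Finset.card (by
        obtain ⟨U, hU⟩ := exists_upperDist_eq J F
        exact ⟨U, by simpa using hU⟩)
    refine ⟨U, by simpa using hU, fun V h1 h2 => hmax V (by simp [h1, ← h2])⟩
  choose U hU hmax using hex
  refine ⟨U, ?_, hU⟩
  intro F G hFG
  have h1 := card_symmDiff_union_add_inter_le F G (U F) (U G)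
  rw [Finset.union_eq_right.2 hFG, Finset.inter_eq_left.2 hFG, ← (hU F).2, ← (hU G).2] at h1
  have h2 := upperDist_le ((hU F).1.inter (hU G).1) F
  have h3 := upperDist_le ((hU F).1.union (hU G).1) G
  have h4 := hmax G _ ((hU F).1.union (hU G).1) (by omega)
  have h5 := Finset.eq_of_subset_of_card_le (Finset.subset_union_right (s₁ := U F)) h4
  intro x hx
  rw [h5]
  exact Finset.mem_union_left _ hx

end UpperSets
/-! ### Dimension reduction -/

section DimensionReduction

variable {n d : ℕ}

/-- If `F` is already closed under increasing the coordinate `r`, then being closed under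
increasing `r` costs nothing extra: nearest `J`-upper sets of the slices of `F` orthogonal to `r`
grow with the slice. -/
lemma upperDist_insert_eq {J : Finset (Fin d)} {r : Fin d} (hr : r ∉ J)
    {F : Finset (Hypergrid n d)}
    (hF : ∀ x ∈ F, ∀ c, x r ≤ c → Function.update x r c ∈ F) :
    upperDist (insert r J) F = upperDist J F := by
  classical
  apply le_antisymm
  swap
  · obtain ⟨U, hU, e⟩ := exists_upperDist_eq (insert r J) F
    rw [e]
    refine upperDist_le (fun x hx y hxy h => hU x hx y hxy fun i hi => h i ?_) F
    exact fun h => hi (Finset.mem_insert_of_mem h)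
  rcases Nat.eq_zero_or_pos n with rfl | hn
  · have : IsEmpty (Hypergrid 0 d) := ⟨fun x => (x r).elim0⟩
    rw [Finset.eq_empty_of_isEmpty F]
    exact (upperDist_le (U := ∅) (by simp [IsUpperOn]) ∅).trans (by simp)
  let c : Fin n := ⟨0, hn⟩
  obtain ⟨N, hmono, hN⟩ := exists_monotone_nearest (n := n) J
  obtain ⟨V, hV, eV⟩ := exists_upperDist_eq J F
  -- the slice of `F` at height `a`, extended constantly in direction `r`
  let S : Finset (Hypergrid n d) → Fin n → Finset (Hypergrid n d) := fun F a =>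
    Finset.univ.filter fun x => Function.update x r a ∈ F
  have memS : ∀ F a x, x ∈ S F a ↔ Function.update x r a ∈ F := fun F a x => by simp [S]
  let U : Finset (Hypergrid n d) :=
    Finset.univ.filter fun x => Function.update x r c ∈ N (S F (x r))
  have memU : ∀ x, x ∈ U ↔ Function.update x r c ∈ N (S F (x r)) := fun x => by simp [U]
  have hSmono : ∀ a b, a ≤ b → S F a ⊆ S F b := by
    intro a b hab x hx
    rw [memS] at hx ⊢
    have := hF _ hx b (by simpa using hab)
    simpa using this
  have hU : IsUpperOn (insert r J) U := by
    intro x hx y hxy h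
    rw [memU] at hx ⊢
    have h1 := hmono (hSmono (x r) (y r) (hxy r)) hx
    refine (hN _).1 _ h1 _ ?_ ?_
    · intro i
      by_cases hi : i = r
      · subst hi; simp
      · simpa [hi] using hxy i
    · intro i hi
      by_cases hir : i = r
      · subst hir; simp
      · simpa [hir] using h i (by simp [hir, hi])
  refine (upperDist_le hU F).trans ?_
  rw [eV]
  have hfib : ∀ T : Finset (Hypergrid n d),
      T.card = ∑ a : Fin n, (T.filter fun x => x r = a).card := fun T =>
    Finset.card_eq_sum_card_fiberwise (fun x _ => Finset.mem_univ (x r))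
  rw [hfib, hfib (symmDiff F V)]
  refine Finset.sum_le_sum fun a _ => ?_
  -- compare the nearest set of the slice with the competitor that follows `V` at height `c`
  let W : Finset (Hypergrid n d) := Finset.univ.filter fun x =>
    if x r = c then Function.update x r a ∈ V else x ∈ N (S F a)
  have memW : ∀ x, x ∈ W ↔ if x r = c then Function.update x r a ∈ V else x ∈ N (S F a) :=
    fun x => by simp [W]
  have hW : IsUpperOn J W := by
    intro x hx y hxy h
    rw [memW] at hx ⊢
    rw [← h r hr]
    split_ifs at hx ⊢ with hc
    · refine hV _ hx _ ?_ ?_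
      · intro i
        by_cases hi : i = r
        · subst hi; simp
        · simpa [hi] using hxy i
      · intro i hi
        by_cases hir : i = r
        · subst hir; simp
        · simpa [hir] using h i hi
    · exact (hN _).1 x hx y hxy h
  have hle := upperDist_le hW (S F a)
  rw [(hN _).2, ← Finset.card_filter_add_card_filter_not (fun x => x r = c),
    ← Finset.card_filter_add_card_filter_not (s := symmDiff (S F a) W) (fun x => x r = c)] at hle
  have hoff : (symmDiff (S F a) (N (S F a))).filter (fun x => ¬ x r = c) =
      (symmDiff (S F a) W).filter (fun x => ¬ x r = c) := by
    ext x
    simp only [Finset.mem_filter, Finset.mem_symmDiff, memW]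
    by_cases hc : x r = c <;> simp [hc]
  rw [hoff, add_le_add_iff_right] at hle
  have hswap : ∀ T T' : Finset (Hypergrid n d),
      (∀ x, x r = a → (x ∈ T ↔ Function.update x r c ∈ T')) →
      (T.filter fun x => x r = a).card = (T'.filter fun x => x r = c).card := by
    intro T T' h
    refine Finset.card_nbij' (fun x => Function.update x r c) (fun x => Function.update x r a)
      ?_ ?_ ?_ ?_
    · intro x hx
      simp only [Finset.coe_filter, Set.mem_ofPred_eq] at hx ⊢
      exact ⟨(h x hx.2).1 hx.1, by simp⟩
    · intro x hx
      simp only [Finset.coe_filter, Set.mem_ofPred_eq] at hx ⊢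
      refine ⟨(h _ (by simp)).2 ?_, by simp⟩
      rw [Function.update_idem, ← hx.2, Function.update_eq_self]
      exact hx.1
    · intro x hx
      simp only [Finset.coe_filter, Set.mem_ofPred_eq] at hx
      simp [← hx.2]
    · intro x hx
      simp only [Finset.coe_filter, Set.mem_ofPred_eq] at hx
      simp [← hx.2]
  rw [hswap _ (symmDiff (S F a) (N (S F a))), hswap _ (symmDiff (S F a) W)]
  · exact hle
  · intro x hx
    have : Function.update x r a = x := by rw [← hx, Function.update_eq_self]
    simp [Finset.mem_symmDiff, memS, memW, this]
  · intro x hx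
    have : Function.update x r a = x := by rw [← hx, Function.update_eq_self]
    simp [Finset.mem_symmDiff, memS, memU, this, hx]

/-- The sorting key of a point: its value, with ties broken by a linear extension of the
coordinatewise order. -/
noncomputable def sortKey (f : Hypergrid n d → ℝ) (x : Hypergrid n d) :
    ℝ ×ₗ Lex (Hypergrid n d) :=
  toLex (f x, toLex x)

lemma sortKey_lt_iff {f : Hypergrid n d → ℝ} {x y : Hypergrid n d} :
    sortKey f x < sortKey f y ↔ f x < f y ∨ f x = f y ∧ toLex x < toLex y := by
  simp [sortKey, Prod.Lex.toLex_lt_toLex]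

lemma sortKey_injective (f : Hypergrid n d → ℝ) : Function.Injective (sortKey f) := by
  intro x y h
  simpa [sortKey] using (congrArg (fun z => (ofLex z).2) h)

lemma sortKey_le_of_le {f : Hypergrid n d → ℝ} {x y : Hypergrid n d} (hxy : x ≤ y)
    (h : f x ≤ f y) : sortKey f x ≤ sortKey f y := by
  rcases h.lt_or_eq with h | h
  · exact (sortKey_lt_iff.2 (Or.inl h)).le
  · rcases hxy.eq_or_lt with rfl | h'
    · exact le_rfl
    · exact (sortKey_lt_iff.2 (Or.inr ⟨h, Pi.toLex_strictMono h'⟩)).le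

lemma exists_sorted_list (f : Hypergrid n d → ℝ) : ∃ L : List (Hypergrid n d), L.Nodup ∧
    (∀ x, x ∈ L) ∧ L.Pairwise fun x y => sortKey f y < sortKey f x := by
  let r : Hypergrid n d → Hypergrid n d → Prop := fun x y => sortKey f y ≤ sortKey f x
  have : IsTrans _ r := ⟨fun _ _ _ h1 h2 => h2.trans h1⟩
  have : Std.Total r := ⟨fun x y => le_total _ _⟩
  have : Std.Antisymm r := ⟨fun x y h1 h2 => sortKey_injective f (le_antisymm h2 h1)⟩
  classical
  refine ⟨Finset.univ.sort r, Finset.sort_nodup _ _, by simp, ?_⟩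
  have h1 := Finset.pairwise_sort (Finset.univ : Finset (Hypergrid n d)) r
  have h2 : (Finset.univ.sort r : List (Hypergrid n d)).Pairwise (· ≠ ·) :=
    Finset.sort_nodup _ _
  exact (h1.and h2).imp fun h =>
    lt_of_le_of_ne h.1 fun e => h.2 (sortKey_injective f e).symm

/-- Listing of the hypergrid in decreasing order of `f`. -/
noncomputable def sortedList (f : Hypergrid n d → ℝ) : List (Hypergrid n d) :=
  (exists_sorted_list f).choose

lemma sortedList_nodup (f : Hypergrid n d → ℝ) : (sortedList f).Nodup :=
  (exists_sorted_list f).choose_spec.1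

lemma mem_sortedList (f : Hypergrid n d → ℝ) (x : Hypergrid n d) : x ∈ sortedList f :=
  (exists_sorted_list f).choose_spec.2.1 x

lemma sortedList_pairwise (f : Hypergrid n d → ℝ) :
    (sortedList f).Pairwise fun x y => sortKey f y < sortKey f x :=
  (exists_sorted_list f).choose_spec.2.2

lemma sortedList_split {f : Hypergrid n d → ℝ} {L₁ L₂ : List (Hypergrid n d)}
    (h : sortedList f = L₁ ++ L₂) {x y : Hypergrid n d} (hx : x ∈ L₁)
    (hxy : sortKey f x ≤ sortKey f y) : y ∈ L₁ := by
  have h1 := sortedList_pairwise f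
  have h2 := mem_sortedList f y
  rw [h] at h1 h2
  rcases List.mem_append.1 h2 with h3 | h3
  · exact h3
  · exact absurd ((List.pairwise_append.1 h1).2.2 x hx y h3) hxy.not_gt

/-- The variation of the distance to `J`-upper sets along the superlevel sets of `f`; it plays
the role of a distance from `f` to functions that are monotone in the coordinates in `J`. -/
noncomputable def levelVariation (J : Finset (Fin d)) (f : Hypergrid n d → ℝ) : ℤ :=
  variation (fun F => (upperDist J F : ℤ)) ∅ (sortedList f)

lemma levelVariation_empty (f : Hypergrid n d → ℝ) : levelVariation ∅ f = 0 := by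
  have h : ∀ F : Finset (Hypergrid n d), upperDist ∅ F = 0 := by
    intro F
    have := upperDist_le (J := ∅) (U := F) (fun x hx y _ h => by
      have : x = y := funext fun i => h i (by simp)
      exact this ▸ hx) F
    simpa using this
  have h2 : ∀ (L : List (Hypergrid n d)) F,
      variation (fun F => (upperDist ∅ F : ℤ)) F L = 0 := by
    intro L
    induction L with
    | nil => intro F; rfl
    | cons v L ih => intro F; simp [variation, h] at ih ⊢; exact ih _
  exact h2 _ _

/-- Changing `f` on `S` increases `levelVariation` by at most `6 |S|`. -/
lemma levelVariation_le_add_of_eq_off {J : Finset (Fin d)} {f g : Hypergrid n d → ℝ}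
    {S : Finset (Hypergrid n d)} (h : ∀ x ∉ S, f x = g x) :
    levelVariation J f ≤ levelVariation J g + 6 * S.card := by
  have hfil : (sortedList f).filter (· ∉ S) = (sortedList g).filter (· ∉ S) := by
    have hperm : List.Perm ((sortedList f).filter (· ∉ S)) ((sortedList g).filter (· ∉ S)) := by
      rw [List.perm_ext_iff_of_nodup ((sortedList_nodup f).filter _)
        ((sortedList_nodup g).filter _)]
      intro x
      simp [mem_sortedList]
    refine hperm.eq_of_pairwise (le := fun x y => sortKey f y < sortKey f x) ?_ ?_ ?_
    · intro a b _ _ h1 h2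
      exact absurd h1 h2.not_gt
    · exact (sortedList_pairwise f).filter _
    · refine ((sortedList_pairwise g).filter _).imp_of_mem ?_
      intro a b ha hb hab
      have ha' : f a = g a := h a (by simpa using (List.mem_filter.1 ha).2)
      have hb' : f b = g b := h b (by simpa using (List.mem_filter.1 hb).2)
      rw [sortKey_lt_iff] at hab ⊢
      rwa [ha', hb']
  have hlen : ∀ u : Hypergrid n d → ℝ,
      ((sortedList u).length : ℤ) - ((sortedList u).filter (· ∉ S)).length ≤ S.card := by
    intro u
    have h1 := List.length_eq_length_filter_add (l := sortedList u) (fun x => decide (x ∉ S))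
    have h2 : ((sortedList u).filter (fun x => !decide (x ∉ S))).length ≤ S.card := by
      rw [← List.toFinset_card_of_nodup ((sortedList_nodup u).filter _)]
      refine Finset.card_le_card fun x hx => ?_
      simpa using (List.mem_toFinset.1 hx |> List.mem_filter.1).2
    omega
  have hdel := fun u : Hypergrid n d → ℝ => abs_le.1 (abs_variation_sub_le_of_sublist
    (m := fun F => (upperDist J F : ℤ)) (fun F G => upperDist_submodular F G)
    (fun F v => abs_upperDist_insert_sub_le F v)
    (List.filter_sublist (p := fun x => decide (x ∉ S)) (l := sortedList u)) ∅
    (sortedList_nodup u) (by simp))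
  have h1 := (hdel f).2
  have h2 := (hdel g).1
  have h3 := hlen f
  have h4 := hlen g
  rw [hfil] at h1 h3
  unfold levelVariation
  linarith

lemma levelVariation_insert_eq {J : Finset (Fin d)} {r : Fin d} (hr : r ∉ J)
    {f : Hypergrid n d → ℝ} (hf : ∀ x c, x r ≤ c → f x ≤ f (Function.update x r c)) :
    levelVariation (insert r J) f = levelVariation J f := by
  refine variation_congr _ _ fun L₁ L₂ e => ?_
  simp only [Finset.empty_union, Nat.cast_inj]
  refine upperDist_insert_eq hr fun x hx c hc => ?_
  rw [List.mem_toFinset] at hx ⊢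
  refine sortedList_split e hx (sortKey_le_of_le ?_ (hf x c hc))
  simpa [le_update_self_iff] using hc

/-- A function that is monotone off `S` can be redefined on `S` so as to become monotone. -/
lemma exists_monotone_extension {α : Type*} [Finite α] [Preorder α] (f : α → ℝ) (S : Set α)
    (h : ∀ x ∉ S, ∀ y ∉ S, x ≤ y → f x ≤ f y) :
    ∃ g : α → ℝ, Monotone g ∧ ∀ x ∉ S, g x = f x := by
  classical
  cases nonempty_fintype α
  rcases isEmpty_or_nonempty α with _ | _
  · exact ⟨f, fun x => isEmptyElim x, fun x => isEmptyElim x⟩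
  let b : ℝ := Finset.univ.inf' Finset.univ_nonempty f
  have hb : ∀ x, b ≤ f x := fun x => Finset.inf'_le _ (Finset.mem_univ x)
  let T : α → Finset ℝ := fun x => insert b ((Finset.univ.filter fun y => y ∉ S ∧ y ≤ x).image f)
  have hT : ∀ x, (T x).Nonempty := fun x => ⟨b, by simp [T]⟩
  refine ⟨fun x => (T x).max' (hT x), ?_, ?_⟩
  · intro x y hxy
    refine Finset.max'_subset _ ?_
    refine Finset.insert_subset_insert _ (Finset.image_subset_image fun z hz => ?_)
    simp only [Finset.mem_filter, Finset.mem_univ, true_and] at hz ⊢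
    exact ⟨hz.1, hz.2.trans hxy⟩
  · intro x hx
    refine le_antisymm (Finset.max'_le _ _ _ ?_) (Finset.le_max' _ _ ?_)
    · intro z hz
      simp only [T, Finset.mem_insert, Finset.mem_image, Finset.mem_filter, Finset.mem_univ,
        true_and] at hz
      rcases hz with rfl | ⟨y, ⟨hy, hyx⟩, rfl⟩
      · exact hb x
      · exact h y hy x hx hyx
    · simp only [T, Finset.mem_insert, Finset.mem_image, Finset.mem_filter, Finset.mem_univ,
        true_and]
      exact Or.inr ⟨x, ⟨hx, le_rfl⟩, rfl⟩

lemma exists_update_monotone_extension (r : Fin d) (f : Hypergrid n d → ℝ)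
    (S : Finset (Hypergrid n d))
    (h : ∀ x ∉ S, ∀ c, x r ≤ c → Function.update x r c ∉ S → f x ≤ f (Function.update x r c)) :
    ∃ g : Hypergrid n d → ℝ, (∀ x c, x r ≤ c → g x ≤ g (Function.update x r c)) ∧
      ∀ x ∉ S, f x = g x := by
  have hex : ∀ x : Hypergrid n d, ∃ g : Fin n → ℝ, Monotone g ∧
      ∀ a ∉ {a | Function.update x r a ∈ S}, g a = f (Function.update x r a) := by
    intro x
    refine exists_monotone_extension _ _ ?_
    intro a ha b hb hab
    have := h _ ha b (by simpa using hab)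
    simp only [Function.update_idem] at this
    exact this hb
  -- the extension is chosen once per line, via the point of the line with `r`-coordinate zero
  choose G hG hGf using hex
  refine ⟨fun x => G (Function.update x r ⟨0, (x r).pos⟩) (x r), ?_, ?_⟩
  · intro x c hc
    simp only [Function.update_self, Function.update_idem]
    exact hG _ hc
  · intro x hx
    simp only
    rw [hGf] <;> simp [hx]

lemma levelVariation_insert_le {J : Finset (Fin d)} {r : Fin d} (hr : r ∉ J)
    {f : Hypergrid n d → ℝ} (S : Finset (Hypergrid n d))
    (h : ∀ x ∉ S, ∀ c, x r ≤ c → Function.update x r c ∉ S → f x ≤ f (Function.update x r c)) :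
    levelVariation (insert r J) f ≤ levelVariation J f + 12 * S.card := by
  obtain ⟨g, hg, hfg⟩ := exists_update_monotone_extension r f S h
  have h1 := levelVariation_le_add_of_eq_off (J := insert r J) hfg
  have h2 := levelVariation_le_add_of_eq_off (J := J) fun x hx => (hfg x hx).symm
  rw [levelVariation_insert_eq hr hg] at h1
  linarith

/-- A function is within Hamming distance `levelVariation univ f` of a monotone function: where
the distance of the superlevel sets does not jump, `f` is monotone. -/
lemma exists_monotone_hammingDist_le_levelVariation (f : Hypergrid n d → ℝ) :
    ∃ g : Hypergrid n d → ℝ, Monotone g ∧ (hammingDist f g : ℤ) ≤ levelVariation .univ f := by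
  obtain ⟨B, hB, hjump⟩ := exists_jumps (fun F : Finset (Hypergrid n d) =>
    (upperDist .univ F : ℤ)) (sortedList f) ∅
  obtain ⟨N, hmono, hN⟩ := exists_monotone_nearest (n := n) (d := d) .univ
  have hgood : ∀ x ∉ B, ∃ L₁ L₂, sortedList f = L₁ ++ x :: L₂ ∧
      x ∈ N (insert x L₁.toFinset) ∧ x ∉ N L₁.toFinset := by
    intro x hx
    obtain ⟨L₁, L₂, e, h⟩ := hjump x (mem_sortedList f x) hx
    refine ⟨L₁, L₂, e, ?_⟩
    simp only [Finset.empty_union, Nat.cast_inj] at h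
    have hxL : x ∉ L₁.toFinset := by
      have := sortedList_nodup f
      rw [e] at this
      have := (List.nodup_append.1 this).2.2
      intro hx
      exact this x (List.mem_toFinset.1 hx) x (by simp) rfl
    constructor
    · by_contra hxN
      have h1 := upperDist_le (hN (insert x L₁.toFinset)).1 L₁.toFinset
      rw [← h, (hN _).2] at h1
      refine absurd h1 (not_le.2 (Finset.card_lt_card ?_))
      refine Finset.ssubset_iff_subset_ne.2 ⟨?_, ?_⟩
      · intro y hy
        simp only [Finset.mem_symmDiff, Finset.mem_insert] at hy ⊢
        rcases hy with ⟨h1, h2⟩ | ⟨h1, h2⟩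
        · exact Or.inl ⟨Or.inr h1, h2⟩
        · refine Or.inr ⟨h1, ?_⟩
          rintro (rfl | h3)
          · exact hxN h1
          · exact h2 h3
      · intro e
        have : x ∈ symmDiff (insert x L₁.toFinset) (N (insert x L₁.toFinset)) := by
          simp [Finset.mem_symmDiff, hxN]
        rw [← e] at this
        simp only [Finset.mem_symmDiff] at this
        tauto
    · intro hxN
      have h1 := upperDist_le (hN L₁.toFinset).1 (insert x L₁.toFinset)
      rw [h, (hN _).2] at h1
      refine absurd h1 (not_le.2 (Finset.card_lt_card ?_))
      refine Finset.ssubset_iff_subset_ne.2 ⟨?_, ?_⟩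
      · intro y hy
        simp only [Finset.mem_symmDiff, Finset.mem_insert] at hy ⊢
        rcases hy with ⟨rfl | h1, h2⟩ | ⟨h1, h2⟩
        · exact absurd hxN h2
        · exact Or.inl ⟨h1, h2⟩
        · exact Or.inr ⟨h1, fun h3 => h2 (Or.inr h3)⟩
      · intro e
        have : x ∈ symmDiff L₁.toFinset (N L₁.toFinset) := by
          simp only [Finset.mem_symmDiff]
          exact Or.inr ⟨hxN, hxL⟩
        rw [← e] at this
        simp only [Finset.mem_symmDiff, Finset.mem_insert] at this
        tauto
  have hB' : ∀ x ∉ (B : Set (Hypergrid n d)), ∀ y ∉ (B : Set (Hypergrid n d)),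
      x ≤ y → f x ≤ f y := by
    intro x hx y hy hxy
    by_contra! hlt
    obtain ⟨L₁, L₂, e, hx1, -⟩ := hgood x (by simpa using hx)
    obtain ⟨M₁, M₂, e', -, hy2⟩ := hgood y (by simpa using hy)
    have hyx : sortKey f y < sortKey f x := sortKey_lt_iff.2 (Or.inl hlt)
    have hyM : y ∉ M₁ := by
      have := sortedList_nodup f
      rw [e'] at this
      have := (List.nodup_append.1 this).2.2
      intro hy
      exact this y hy y (by simp) rfl
    have hsub : insert x L₁.toFinset ⊆ M₁.toFinset := by
      have hxM : x ∈ M₁ := by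
        have h3 := sortedList_split (L₁ := M₁ ++ [y]) (L₂ := M₂) (by simp [e'])
          (x := y) (by simp) hyx.le
        rcases List.mem_append.1 h3 with h3 | h3
        · exact h3
        · simp only [List.mem_singleton] at h3
          subst h3
          exact absurd hlt (lt_irrefl _)
      intro z hz
      rcases Finset.mem_insert.1 hz with rfl | hz
      · exact List.mem_toFinset.2 hxM
      · have hs := sortedList_pairwise f
        rw [e] at hs
        have := (List.pairwise_append.1 hs).2.2 z (List.mem_toFinset.1 hz) x (by simp)
        exact List.mem_toFinset.2 (sortedList_split e' hxM this.le)
    exact hy2 ((hN _).1 x (hmono hsub hx1) y hxy (by simp))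
  obtain ⟨g, hg, hgf⟩ := exists_monotone_extension f (B : Set (Hypergrid n d)) hB'
  refine ⟨g, hg, le_trans ?_ hB⟩
  unfold hammingDist
  refine Nat.cast_le.2 (Finset.card_le_card fun x hx => ?_)
  by_contra hxB
  exact (Finset.mem_filter.1 hx).2 (hgf x (by simpa using hxB)).symm

/-- **Dimension reduction for monotonicity.** If, for every `i`, deleting the points of `S i`
makes `f` monotone on the lines of direction `i`, then `f` can be made monotone by changing
`12 ∑ i, |S i|` values. -/
theorem exists_monotone_hammingDist_le (f : Hypergrid n d → ℝ) (S : Fin d → Finset (Hypergrid n d))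
    (h : ∀ i, ∀ x ∉ S i, ∀ c, x i ≤ c → Function.update x i c ∉ S i →
      f x ≤ f (Function.update x i c)) :
    ∃ g : Hypergrid n d → ℝ, Monotone g ∧ hammingDist f g ≤ 12 * ∑ i, (S i).card := by
  obtain ⟨g, hg, hd⟩ := exists_monotone_hammingDist_le_levelVariation f
  refine ⟨g, hg, ?_⟩
  have key : ∀ J : Finset (Fin d), levelVariation J f ≤ 12 * ∑ i ∈ J, ((S i).card : ℤ) := by
    intro J
    induction J using Finset.induction_on with
    | empty => simp [levelVariation_empty]
    | insert r J hr ih =>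
      have := levelVariation_insert_le hr (S r) (h r)
      rw [Finset.sum_insert hr]
      linarith
  have := key .univ
  zify
  linarith

/-- Dimension reduction for an arbitrary choice of the directions of monotonicity: `f` is to be
nondecreasing in the coordinates `i` with `b i = true` and nonincreasing in the others. -/
theorem exists_unate_hammingDist_le (f : Hypergrid n d → ℝ) (b : Fin d → Bool)
    (S : Fin d → Finset (Hypergrid n d))
    (h : ∀ i, ∀ x ∉ S i, ∀ c, x i ≤ c → Function.update x i c ∉ S i →
      if b i then f x ≤ f (Function.update x i c) else f (Function.update x i c) ≤ f x) :
    ∃ g ∈ Unate n d, hammingDist f g ≤ 12 * ∑ i, (S i).card := by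
  -- reflect the coordinates with `b i = false`
  let ρ : Hypergrid n d → Hypergrid n d := fun x i => if b i then x i else (x i).rev
  have hρρ : ∀ x, ρ (ρ x) = x := fun x => funext fun i => by
    by_cases hb : b i <;> simp [ρ, hb]
  have hinj : Function.Injective ρ := Function.LeftInverse.injective hρρ
  have hupd : ∀ x i c, ρ (Function.update x i c) =
      Function.update (ρ x) i (if b i then c else c.rev) := by
    intro x i c
    funext j
    by_cases hj : j = i
    · subst hj; simp [ρ]
    · simp [ρ, hj]
  obtain ⟨g, hg, hd⟩ := exists_monotone_hammingDist_le (f ∘ ρ) (fun i => (S i).image ρ) (by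
    have hmem : ∀ i x, x ∉ (S i).image ρ → ρ x ∉ S i := fun i x hx hx' =>
      hx (Finset.mem_image.2 ⟨ρ x, hx', hρρ x⟩)
    intro i x hx c hc hxc
    have hx := hmem _ _ hx
    have hxc := hmem _ _ hxc
    simp only [Function.comp_apply]
    rw [hupd] at hxc ⊢
    by_cases hb : b i
    · simp only [hb, if_true] at hxc ⊢
      simpa [hb] using h i _ hx c (by simpa [ρ, hb] using hc) hxc
    · simp only [hb] at hxc ⊢
      have := h i _ hxc (ρ x i) (by simpa [ρ, hb] using hc) (by simpa using hx)
      simpa [hb] using this)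
  refine ⟨g ∘ ρ, ?_, ?_⟩
  · intro i
    by_cases hb : b i
    · refine Or.inl fun x a c hac => hg ?_
      rw [hupd, hupd, update_le_update_iff']
      simpa [hb] using hac
    · refine Or.inr fun x a c hac => hg ?_
      rw [hupd, hupd, update_le_update_iff']
      simpa [hb] using hac
  · refine le_trans (le_of_eq ?_) (hd.trans ?_)
    · unfold hammingDist
      refine Finset.card_nbij' ρ ρ ?_ ?_ ?_ ?_
      · intro x hx; simpa [hρρ] using hx
      · intro x hx; simpa [hρρ] using hx
      · intro x _; exact hρρ x
      · intro x _; exact hρρ x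
    · refine Nat.mul_le_mul_left _ (Finset.sum_le_sum fun i _ => Finset.card_image_le)

end DimensionReduction
/-! ### Sampling a single line -/

section Line

variable {n : ℕ}

/-- The function `g` takes a larger value at the smaller of the points `x`, `y`. -/
def Inverted (g : Fin n → ℝ) (x y : Fin n) : Prop :=
  (x < y ∧ g y < g x) ∨ (y < x ∧ g x < g y)

/-- Some two points of `Q` witness that `g` is not nondecreasing. -/
def HasDecrease (g : Fin n → ℝ) (Q : List (Fin n)) : Prop :=
  ∃ a ∈ Q, ∃ b ∈ Q, a < b ∧ g b < g a

/-- Some two points of `Q` witness that `g` is not nonincreasing. -/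
def HasIncrease (g : Fin n → ℝ) (Q : List (Fin n)) : Prop :=
  ∃ a ∈ Q, ∃ b ∈ Q, a < b ∧ g a < g b

lemma hasDecrease_neg {g : Fin n → ℝ} {Q : List (Fin n)} :
    HasDecrease (fun a => -g a) Q ↔ HasIncrease g Q := by
  simp [HasDecrease, HasIncrease]

lemma hasIncrease_neg {g : Fin n → ℝ} {Q : List (Fin n)} :
    HasIncrease (fun a => -g a) Q ↔ HasDecrease g Q := by
  simp [HasDecrease, HasIncrease]

lemma Inverted.symm {g : Fin n → ℝ} {x y : Fin n} (h : Inverted g x y) : Inverted g y x := by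
  unfold Inverted at *
  tauto

lemma Inverted.hasDecrease {g : Fin n → ℝ} {x y : Fin n} (h : Inverted g x y) {Q : List (Fin n)}
    (hx : x ∈ Q) (hy : y ∈ Q) : HasDecrease g Q := by
  rcases h with h | h
  · exact ⟨x, hx, y, hy, h⟩
  · exact ⟨y, hy, x, hx, h⟩

/-- The `k`-th probe around `x`: if `r` is a uniform residue modulo a multiple of `2 ^ (k + 1)`,
it is a uniform point of the window of radius `2 ^ k` around `x` (clamped to the line). A single
`r` serves all scales `k`, since no independence between scales is needed. -/
def probe (x : Fin n) (r k : ℕ) : Fin n :=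
  ⟨min (x + r % 2 ^ (k + 1) - 2 ^ k) (n - 1), by have := x.2; omega⟩

/-- The points of a line queried on the seed `(x, r, z)`: the point `x`, the far point `z`, and
one point at each of the scales `0, …, K` around `x`. -/
def lineSample (K : ℕ) (x : Fin n) (r : ℕ) (z : Fin n) : List (Fin n) :=
  x :: z :: (List.range (K + 1)).map (probe x r)

lemma probe_mem_lineSample {K k : ℕ} (hk : k ≤ K) (x : Fin n) (r : ℕ) (z : Fin n) :
    probe x r k ∈ lineSample K x r z := by
  simp only [lineSample, List.mem_cons, List.mem_map, List.mem_range]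
  exact Or.inr (Or.inr ⟨k, by omega, rfl⟩)

lemma length_lineSample (K : ℕ) (x : Fin n) (r : ℕ) (z : Fin n) :
    (lineSample K x r z).length = K + 3 := by
  simp [lineSample]

lemma mul_card_le_card_probe {K k : ℕ} (hk : k ≤ K) (x : Fin n) (Y : Finset (Fin n))
    (hY : ∀ y ∈ Y, (x : ℕ) < y + 2 ^ k ∧ (y : ℕ) < x + 2 ^ k) :
    2 ^ (K - k) * Y.card ≤
      (Finset.univ.filter fun r : Fin (2 ^ (K + 1)) => probe x r k ∈ Y).card := by
  have hpow : 2 ^ (K + 1) = 2 ^ (K - k) * 2 ^ (k + 1) := by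
    rw [← pow_add]; congr 1; omega
  have hpk : 2 ^ (k + 1) = 2 * 2 ^ k := by rw [pow_succ, mul_comm]
  have hpos : 0 < 2 ^ k := by positivity
  rw [← Finset.card_range (2 ^ (K - k)), ← Finset.card_product]
  refine Finset.card_le_card_of_injOn
    (fun p => Fin.ofNat (2 ^ (K + 1)) (p.1 * 2 ^ (k + 1) + (p.2 + 2 ^ k - x))) ?_ ?_
  all_goals
    have hval : ∀ p ∈ Finset.range (2 ^ (K - k)) ×ˢ Y,
        ((Fin.ofNat (2 ^ (K + 1)) (p.1 * 2 ^ (k + 1) + (p.2 + 2 ^ k - x)) :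
          Fin (2 ^ (K + 1))) : ℕ) = p.1 * 2 ^ (k + 1) + (p.2 + 2 ^ k - x) ∧
        (p.2 + 2 ^ k - x : ℕ) < 2 ^ (k + 1) ∧ (x : ℕ) < p.2 + 2 ^ k := by
      intro p hp
      simp only [Finset.mem_product, Finset.mem_range] at hp
      have h1 := hY _ hp.2
      have h2 : (p.2 + 2 ^ k - x : ℕ) < 2 ^ (k + 1) := by omega
      refine ⟨?_, h2, h1.1⟩
      simp only [Fin.ofNat]
      refine Nat.mod_eq_of_lt ?_
      calc p.1 * 2 ^ (k + 1) + (p.2 + 2 ^ k - x) < (p.1 + 1) * 2 ^ (k + 1) := by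
            rw [add_mul, one_mul]; omega
        _ ≤ 2 ^ (K - k) * 2 ^ (k + 1) := Nat.mul_le_mul_right _ hp.1
        _ = 2 ^ (K + 1) := hpow.symm
  · intro p hp
    have hp' := hp
    simp only [Finset.coe_product, Set.mem_prod, Finset.mem_coe] at hp'
    obtain ⟨h1, h2, h3⟩ := hval p (by exact_mod_cast hp)
    simp only [Finset.coe_filter, Finset.mem_univ, true_and, Set.mem_ofPred_eq]
    convert hp'.2
    apply Fin.ext
    simp only [probe]
    rw [h1, mul_comm p.1, Nat.mul_add_mod, Nat.mod_eq_of_lt h2]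
    have := p.2.2
    omega
  · intro p hp q hq e
    obtain ⟨h1, h2, h3⟩ := hval p (by exact_mod_cast hp)
    obtain ⟨h1', h2', h3'⟩ := hval q (by exact_mod_cast hq)
    have e := congrArg Fin.val e
    simp only at e
    rw [h1, h1'] at e
    have e1 : p.1 = q.1 := by
      have := congrArg (· / 2 ^ (k + 1)) e
      simpa [Nat.add_div_of_dvd_right, Nat.mul_div_cancel, Nat.div_eq_of_lt h2,
        Nat.div_eq_of_lt h2'] using this
    refine Prod.ext e1 (Fin.ext ?_)
    rw [e1] at e
    omega

open scoped Classical in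
/-- The points that are inverted with a constant fraction of a window around them. -/
noncomputable def locallyBad (K : ℕ) (g : Fin n → ℝ) : Finset (Fin n) :=
  Finset.univ.filter fun x => ∃ k ≤ K, 2 ^ k ≤ 4 * (Finset.univ.filter fun y : Fin n =>
    Inverted g x y ∧ (x : ℕ) < y + 2 ^ k ∧ (y : ℕ) < x + 2 ^ k).card

/-- Deleting the locally bad points makes `g` monotone: every point between the two points of an
inverted pair is inverted with one of them. -/
lemma le_of_notMem_locallyBad {K : ℕ} (hK : n ≤ 2 ^ K) (g : Fin n → ℝ) {x y : Fin n} (hxy : x ≤ y)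
    (hx : x ∉ locallyBad K g) (hy : y ∉ locallyBad K g) : g x ≤ g y := by
  classical
  by_contra! hlt
  have hxy : x < y := lt_of_le_of_ne hxy fun e => by simp [e] at hlt
  have hxy' : (x : ℕ) < y := hxy
  let k := Nat.log 2 (y - x : ℕ) + 1
  have hk1 : (y - x : ℕ) < 2 ^ k := Nat.lt_pow_succ_log_self (by norm_num) _
  have hk2 : 2 ^ k ≤ 2 * (y - x : ℕ) := by
    have := Nat.pow_log_le_self 2 (x := (y - x : ℕ)) (by omega)
    simp only [k, pow_succ]
    omega
  have hkK : k ≤ K := by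
    have h1 : Nat.log 2 (y - x : ℕ) < K := Nat.log_lt_of_lt_pow (by omega) (by omega)
    omega
  simp only [locallyBad, Finset.mem_filter, Finset.mem_univ, true_and, not_exists, not_and,
    not_le] at hx hy
  have hx := hx k hkK
  have hy := hy k hkK
  set A := Finset.univ.filter fun z : Fin n =>
    Inverted g x z ∧ (x : ℕ) < z + 2 ^ k ∧ (z : ℕ) < x + 2 ^ k
  set B := Finset.univ.filter fun z : Fin n =>
    Inverted g y z ∧ (y : ℕ) < z + 2 ^ k ∧ (z : ℕ) < y + 2 ^ k
  have hsub : Finset.Icc x y ⊆ A ∪ B := by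
    intro z hz
    rw [Finset.mem_Icc] at hz
    have h1 : (x : ℕ) ≤ z := hz.1
    have h2 : (z : ℕ) ≤ y := hz.2
    simp only [A, B, Finset.mem_union, Finset.mem_filter, Finset.mem_univ, true_and]
    by_cases hgz : g z < g x
    · left
      refine ⟨Or.inl ⟨lt_of_le_of_ne hz.1 fun e => ?_, hgz⟩, by omega, by omega⟩
      simp [e] at hgz
    · right
      have hgz' : g y < g z := by linarith
      refine ⟨Or.inr ⟨lt_of_le_of_ne hz.2 fun e => ?_, hgz'⟩, by omega, by omega⟩
      simp [e] at hgz'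
  have h1 := (Finset.card_le_card hsub).trans (Finset.card_union_le A B)
  rw [Fin.card_Icc] at h1
  omega

lemma le_card_hasDecrease {K : ℕ} {g : Fin n → ℝ} {x : Fin n} (hx : x ∈ locallyBad K g)
    (z : Fin n) (p : Fin (2 ^ (K + 1)) → Prop) [DecidablePred p]
    (hp : ∀ r : Fin (2 ^ (K + 1)), HasDecrease g (lineSample K x r z) → p r) :
    2 ^ (K + 1) ≤ 8 * (Finset.univ.filter p).card := by
  classical
  simp only [locallyBad, Finset.mem_filter, Finset.mem_univ, true_and] at hx
  obtain ⟨k, hk, h⟩ := hx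
  set Y := Finset.univ.filter fun y : Fin n =>
    Inverted g x y ∧ (x : ℕ) < y + 2 ^ k ∧ (y : ℕ) < x + 2 ^ k with hY
  have h1 := mul_card_le_card_probe hk x Y fun y hy => (Finset.mem_filter.1 hy).2.2
  have h2 : (Finset.univ.filter fun r : Fin (2 ^ (K + 1)) => probe x r k ∈ Y).card ≤
      (Finset.univ.filter p).card := by
    refine Finset.card_le_card fun r hr => ?_
    simp only [hY, Finset.mem_filter, Finset.mem_univ, true_and] at hr ⊢
    exact hp r (hr.1.hasDecrease (by simp [lineSample]) (probe_mem_lineSample hk x r z))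
  have h3 : 2 ^ (K + 1) = 2 * (2 ^ (K - k) * 2 ^ k) := by
    rw [← pow_add, Nat.sub_add_cancel hk, pow_succ, mul_comm]
  have h4 := Nat.mul_le_mul_left (2 ^ (K - k)) h
  refine h3.le.trans ?_
  linarith

/-- One-sided discrete Hardy–Littlewood maximal inequality, in the manner of the rising sun
lemma. -/
lemma card_le_mul_card_of_left_dense (C : ℕ) : ∀ (N : ℕ) (E : Finset ℤ),
    E.card = N → ∀ W : Finset ℤ,
    (∀ x ∈ E, ∃ s : ℕ, s ≠ 0 ∧ s ≤ C * (W.filter fun w => w < x ∧ x ≤ w + s).card) →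
    E.card ≤ C * W.card := by
  intro N
  induction N using Nat.strong_induction_on with
  | _ N ih =>
    intro E hE W h
    rcases E.eq_empty_or_nonempty with rfl | hne
    · simp
    set x := E.max' hne with hx
    obtain ⟨s, hs0, hs⟩ := h x (E.max'_mem hne)
    set E' := E.filter (· ≤ x - s)
    set W' := W.filter (· < x - s)
    have hE' : E'.card < N := by
      rw [← hE]
      refine Finset.card_lt_card (Finset.filter_ssubset.2 ⟨x, E.max'_mem hne, ?_⟩)
      omega
    have h1 : E'.card ≤ C * W'.card := by
      refine ih _ hE' E' rfl W' fun y hy => ?_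
      obtain ⟨t, ht0, ht⟩ := h y (Finset.mem_filter.1 hy).1
      refine ⟨t, ht0, ht.trans (Nat.mul_le_mul_left _ (Finset.card_le_card fun w hw => ?_))⟩
      have := (Finset.mem_filter.1 hy).2
      simp only [W', Finset.mem_filter] at hw ⊢
      refine ⟨⟨hw.1, by omega⟩, hw.2⟩
    have h2 : E.card ≤ E'.card + s := by
      have hsub : E ⊆ E' ∪ Finset.Ioc (x - s) x := by
        intro y hy
        have := E.le_max' y hy
        simp only [E', Finset.mem_union, Finset.mem_filter, Finset.mem_Ioc]
        by_cases hyx : y ≤ x - s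
        · exact Or.inl ⟨hy, hyx⟩
        · exact Or.inr ⟨by omega, this⟩
      refine (Finset.card_le_card hsub).trans ((Finset.card_union_le _ _).trans ?_)
      simp
    have h3 : (W.filter fun w => w < x ∧ x ≤ w + s).card + W'.card ≤ W.card := by
      rw [← Finset.card_union_of_disjoint]
      · exact Finset.card_le_card (Finset.union_subset (Finset.filter_subset _ _)
          (Finset.filter_subset _ _))
      · refine Finset.disjoint_left.2 fun w hw hw' => ?_
        simp only [W', Finset.mem_filter] at hw hw'
        omega
    calc E.card ≤ C * W'.card + C * (W.filter fun w => w < x ∧ x ≤ w + s).card := by omega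
      _ ≤ C * W.card := by rw [← mul_add]; exact Nat.mul_le_mul_left _ (by omega)

lemma card_le_mul_card_of_right_dense (C : ℕ) (E W : Finset ℤ)
    (h : ∀ x ∈ E, ∃ s : ℕ, s ≠ 0 ∧ s ≤ C * (W.filter fun w => x < w ∧ w ≤ x + s).card) :
    E.card ≤ C * W.card := by
  have := card_le_mul_card_of_left_dense C _ (E.image (- ·)) rfl (W.image (- ·)) (by
    intro x hx
    obtain ⟨y, hy, rfl⟩ := Finset.mem_image.1 hx
    obtain ⟨s, hs0, hs⟩ := h y hy
    refine ⟨s, hs0, hs.trans (Nat.mul_le_mul_left _ (le_of_eq ?_))⟩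
    rw [Finset.filter_image, Finset.card_image_of_injective _ neg_injective]
    congr 1
    ext w
    simp only [Finset.mem_filter]
    constructor <;> rintro ⟨h1, h2, h3⟩ <;> exact ⟨h1, by omega, by omega⟩)
  rwa [Finset.card_image_of_injective _ neg_injective,
    Finset.card_image_of_injective _ neg_injective] at this

open scoped Classical in
lemma card_dense_le (W : Finset (Fin n)) :
    (Finset.univ.filter fun x : Fin n => ∃ k : ℕ, 2 ^ k ≤ 16 *
      (W.filter fun w => w < x ∧ (x : ℕ) < w + 2 ^ k).card).card ≤ 16 * W.card ∧
    (Finset.univ.filter fun x : Fin n => ∃ k : ℕ, 2 ^ k ≤ 16 *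
      (W.filter fun w => x < w ∧ (w : ℕ) < x + 2 ^ k).card).card ≤ 16 * W.card := by
  have hinj : Function.Injective fun x : Fin n => ((x : ℕ) : ℤ) := fun x y h =>
    Fin.ext (Int.natCast_inj.1 h)
  constructor
  · have := card_le_mul_card_of_left_dense 16 _ ((Finset.univ.filter fun x : Fin n =>
      ∃ k : ℕ, 2 ^ k ≤ 16 * (W.filter fun w => w < x ∧ (x : ℕ) < w + 2 ^ k).card).image
        fun x : Fin n => ((x : ℕ) : ℤ)) rfl (W.image fun x : Fin n => ((x : ℕ) : ℤ)) (by
      intro y hy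
      obtain ⟨x, hx, rfl⟩ := Finset.mem_image.1 hy
      obtain ⟨k, hk⟩ := (Finset.mem_filter.1 hx).2
      refine ⟨2 ^ k, by positivity, hk.trans (Nat.mul_le_mul_left _ ?_)⟩
      rw [Finset.filter_image, Finset.card_image_of_injective _ hinj]
      refine Finset.card_le_card fun w hw => ?_
      simp only [Finset.mem_filter, Fin.lt_def] at hw ⊢
      refine ⟨hw.1, by exact_mod_cast hw.2.1, by exact_mod_cast hw.2.2.le⟩)
    rwa [Finset.card_image_of_injective _ hinj, Finset.card_image_of_injective _ hinj] at this
  · have := card_le_mul_card_of_right_dense 16 ((Finset.univ.filter fun x : Fin n =>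
      ∃ k : ℕ, 2 ^ k ≤ 16 * (W.filter fun w => x < w ∧ (w : ℕ) < x + 2 ^ k).card).image
        fun x : Fin n => ((x : ℕ) : ℤ)) (W.image fun x : Fin n => ((x : ℕ) : ℤ)) (by
      intro y hy
      obtain ⟨x, hx, rfl⟩ := Finset.mem_image.1 hy
      obtain ⟨k, hk⟩ := (Finset.mem_filter.1 hx).2
      refine ⟨2 ^ k, by positivity, hk.trans (Nat.mul_le_mul_left _ ?_)⟩
      rw [Finset.filter_image, Finset.card_image_of_injective _ hinj]
      refine Finset.card_le_card fun w hw => ?_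
      simp only [Finset.mem_filter, Fin.lt_def] at hw ⊢
      refine ⟨hw.1, by exact_mod_cast hw.2.1, by exact_mod_cast hw.2.2.le⟩)
    rwa [Finset.card_image_of_injective _ hinj, Finset.card_image_of_injective _ hinj] at this

open scoped Classical in
/-- The points inverted with `x`. -/
noncomputable def inversions (g : Fin n → ℝ) (x : Fin n) : Finset (Fin n) :=
  Finset.univ.filter (Inverted g x)

lemma HasIncrease.mono {g : Fin n → ℝ} {Q Q' : List (Fin n)} (h : HasIncrease g Q) (hQ : Q ⊆ Q') :
    HasIncrease g Q' := by
  obtain ⟨a, ha, b, hb, h⟩ := h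
  exact ⟨a, hQ ha, b, hQ hb, h⟩

lemma hasIncrease_of_not_inverted {g : Fin n → ℝ} {x y z : Fin n} (hxy : x < y) (hg : g y < g x)
    (hx : ¬ Inverted g x z) (hy : ¬ Inverted g y z) (hz : z < x ∨ y < z) :
    HasIncrease g [x, y, z] := by
  simp only [Inverted, not_or, not_and, not_lt] at hx hy
  rcases hz with hz | hz
  · exact ⟨z, by simp, x, by simp, hz, (hy.2 (hz.trans hxy)).trans_lt hg⟩
  · exact ⟨y, by simp, z, by simp, hz, hg.trans_le (hx.1 (hxy.trans hz))⟩

/-- If neither point of an inverted pair `x`, `y` has many inversions and the pair is short, then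
most far points `z` form an increasing pair with `x` or with `y`. -/
lemma le_card_hasIncrease {g : Fin n → ℝ} {x y : Fin n} (hxy : Inverted g x y)
    (hx : 16 * (inversions g x).card < n) (hy : 16 * (inversions g y).card < n) {c : ℕ}
    (h1 : (x : ℕ) < y + c) (h2 : (y : ℕ) < x + c) (hc : c ≤ 4 * (inversions g x).card)
    (p : Fin n → Prop) [DecidablePred p]
    (hp : ∀ z, HasIncrease g [x, y, z] → p z) :
    n ≤ 2 * (Finset.univ.filter p).card := by
  classical
  have hsub : (Finset.univ : Finset (Fin n)) ⊆ Finset.univ.filter p ∪ (inversions g x ∪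
      (inversions g y ∪ Finset.Icc (min x y) (max x y))) := by
    intro z _
    by_contra hz
    simp only [Finset.mem_union, not_or, inversions, Finset.mem_filter, Finset.mem_univ,
      true_and, Finset.mem_Icc, not_and_or, not_le] at hz
    obtain ⟨hpz, hxz, hyz, hz⟩ := hz
    apply hpz
    apply hp
    rcases hxy with ⟨h, hg⟩ | ⟨h, hg⟩
    · rw [min_eq_left h.le, max_eq_right h.le] at hz
      exact hasIncrease_of_not_inverted h hg hxz hyz hz
    · rw [min_eq_right h.le, max_eq_left h.le] at hz
      exact (hasIncrease_of_not_inverted h hg hyz hxz hz).mono (by simp)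
  have h3 := (Finset.card_le_card hsub).trans (Finset.card_union_le _ _)
  have h4 := Finset.card_union_le (inversions g x)
    (inversions g y ∪ Finset.Icc (min x y) (max x y))
  have h5 := Finset.card_union_le (inversions g y) (Finset.Icc (min x y) (max x y))
  have h6 : (Finset.Icc (min x y) (max x y)).card ≤ c := by
    rw [Fin.card_Icc]
    rcases le_total x y with h | h
    · rw [min_eq_left h, max_eq_right h]; omega
    · rw [min_eq_right h, max_eq_left h]; omega
  rw [Finset.card_univ, Fintype.card_fin] at h3
  omega

open scoped Classical in
/-- **Local inversions are seen together with an increase.** On a line, the number of locally bad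
points is controlled by the number of all inverted pairs, and the number of seeds for which the
sample contains both a decrease and an increase. -/
theorem card_locallyBad_le (K : ℕ) (g : Fin n → ℝ) :
    n * 2 ^ (K + 1) * (locallyBad K g).card ≤
      528 * 2 ^ (K + 1) * ∑ x, (inversions g x).card +
      32 * ∑ x, (Finset.univ.filter fun p : Fin (2 ^ (K + 1)) × Fin n =>
        HasDecrease g (lineSample K x p.1 p.2) ∧ HasIncrease g (lineSample K x p.1 p.2)).card := by
  set W : Finset (Fin n) := Finset.univ.filter fun x => n ≤ 16 * (inversions g x).card with hW
  obtain ⟨hleft, hright⟩ := card_dense_le W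
  set El : Finset (Fin n) := Finset.univ.filter fun x : Fin n => ∃ k : ℕ, 2 ^ k ≤ 16 *
      (W.filter fun w => w < x ∧ (x : ℕ) < w + 2 ^ k).card with hEl
  set Er : Finset (Fin n) := Finset.univ.filter fun x : Fin n => ∃ k : ℕ, 2 ^ k ≤ 16 *
      (W.filter fun w => x < w ∧ (w : ℕ) < x + 2 ^ k).card with hEr
  set R : Finset (Fin n) := (locallyBad K g).filter fun x => x ∉ W ∧ x ∉ El ∧ x ∉ Er with hR
  set t : Fin n → ℕ := fun x => (Finset.univ.filter fun p : Fin (2 ^ (K + 1)) × Fin n =>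
    HasDecrease g (lineSample K x p.1 p.2) ∧ HasIncrease g (lineSample K x p.1 p.2)).card with ht
  have hW1 : n * W.card ≤ 16 * ∑ x, (inversions g x).card := by
    rw [Finset.mul_sum, mul_comm, ← smul_eq_mul]
    refine (Finset.card_nsmul_le_sum W _ n fun x hx => (Finset.mem_filter.1 hx).2).trans ?_
    exact Finset.sum_le_sum_of_subset (Finset.subset_univ W)
  have hcard : (locallyBad K g).card ≤ 33 * W.card + R.card := by
    have hsub : locallyBad K g ⊆ W ∪ (El ∪ (Er ∪ R)) := by
      intro x hx
      simp only [hR, Finset.mem_union, Finset.mem_filter]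
      tauto
    have h1 := (Finset.card_le_card hsub).trans (Finset.card_union_le _ _)
    have h2 := Finset.card_union_le El (Er ∪ R)
    have h3 := Finset.card_union_le Er R
    omega
  have hRx : ∀ x ∈ R, 2 ^ (K + 1) * n ≤ 32 * t x := by
    intro x hx
    simp only [hR, Finset.mem_filter] at hx
    obtain ⟨hxV, hxW, hxl, hxr⟩ := hx
    simp only [locallyBad, Finset.mem_filter, Finset.mem_univ, true_and] at hxV
    obtain ⟨k, hk, hY⟩ := hxV
    simp only [hEl, hEr, Finset.mem_filter, Finset.mem_univ, true_and, not_exists, not_le]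
      at hxl hxr
    have hxl := hxl k
    have hxr := hxr k
    set Y := Finset.univ.filter fun y : Fin n =>
      Inverted g x y ∧ (x : ℕ) < y + 2 ^ k ∧ (y : ℕ) < x + 2 ^ k with hYdef
    have hYinv : Y.card ≤ (inversions g x).card := Finset.card_le_card fun y hy => by
      simp only [hYdef, inversions, Finset.mem_filter, Finset.mem_univ, true_and] at hy ⊢
      exact hy.1
    -- the violators outside `W` still fill a constant fraction of the window
    have hYW : 2 ^ k ≤ 8 * (Y.filter (· ∉ W)).card := by
      have h1 := Finset.card_filter_add_card_filter_not (s := Y) (· ∈ W)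
      have h2 : (Y.filter (· ∈ W)).card ≤
          (W.filter fun w => w < x ∧ (x : ℕ) < w + 2 ^ k).card +
          (W.filter fun w => x < w ∧ (w : ℕ) < x + 2 ^ k).card := by
        refine (Finset.card_le_card fun w hw => ?_).trans (Finset.card_union_le _ _)
        simp only [hYdef, Finset.mem_filter, Finset.mem_univ, true_and, Finset.mem_union] at hw ⊢
        obtain ⟨⟨-, h3, h4⟩, h5⟩ := hw
        rcases lt_trichotomy w x with h | h | h
        · exact Or.inl ⟨h5, h, h3⟩
        · exact absurd (h ▸ h5) hxW
        · exact Or.inr ⟨h5, h, h4⟩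
      omega
    have hxW' : 16 * (inversions g x).card < n := by
      simpa [hW] using hxW
    have hprobe := mul_card_le_card_probe hk x (Y.filter (· ∉ W)) fun y hy =>
      (Finset.mem_filter.1 (Finset.mem_filter.1 hy).1).2.2
    set P := Finset.univ.filter fun r : Fin (2 ^ (K + 1)) => probe x r k ∈ Y.filter (· ∉ W)
      with hP
    have hfib : ∀ r ∈ P, n ≤ 2 * (Finset.univ.filter fun z : Fin n =>
        HasDecrease g (lineSample K x r z) ∧ HasIncrease g (lineSample K x r z)).card := by
      intro r hr
      simp only [hP, hYdef, hW, Finset.mem_filter, Finset.mem_univ, true_and, not_le] at hr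
      obtain ⟨⟨h1, h2, h3⟩, h4⟩ := hr
      refine le_card_hasIncrease h1 hxW' h4 h2 h3 (by omega) _ fun z hz => ⟨?_, hz.mono ?_⟩
      · exact h1.hasDecrease (by simp [lineSample]) (probe_mem_lineSample hk x r z)
      · intro a ha
        simp only [List.mem_cons, List.not_mem_nil, or_false] at ha
        rcases ha with rfl | rfl | rfl
        · simp [lineSample]
        · exact probe_mem_lineSample hk x r z
        · simp [lineSample]
    have hsum : P.card * n ≤ 2 * t x := by
      have h1 : t x = ∑ r : Fin (2 ^ (K + 1)), (Finset.univ.filter fun z : Fin n =>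
          HasDecrease g (lineSample K x r z) ∧ HasIncrease g (lineSample K x r z)).card := by
        simp only [ht, Finset.card_filter]
        exact Fintype.sum_prod_type _
      rw [h1, Finset.mul_sum, ← smul_eq_mul]
      refine (Finset.card_nsmul_le_sum P _ n hfib).trans ?_
      exact Finset.sum_le_sum_of_subset (Finset.subset_univ P)
    have h3 : 2 ^ (K + 1) = 2 * (2 ^ (K - k) * 2 ^ k) := by
      rw [← pow_add, Nat.sub_add_cancel hk, pow_succ, mul_comm]
    have h4 := Nat.mul_le_mul_left (2 ^ (K - k)) hYW
    have h5 : 2 ^ (K + 1) ≤ 16 * P.card := h3.le.trans (by linarith)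
    calc 2 ^ (K + 1) * n ≤ 16 * P.card * n := Nat.mul_le_mul_right _ h5
      _ ≤ 32 * t x := by linarith
  have hRt : 2 ^ (K + 1) * n * R.card ≤ 32 * ∑ x, t x := by
    rw [Finset.mul_sum, mul_comm, ← smul_eq_mul]
    refine (Finset.card_nsmul_le_sum R _ _ hRx).trans ?_
    exact Finset.sum_le_sum_of_subset (Finset.subset_univ R)
  calc n * 2 ^ (K + 1) * (locallyBad K g).card
      ≤ n * 2 ^ (K + 1) * (33 * W.card + R.card) := Nat.mul_le_mul_left _ hcard
    _ = 33 * 2 ^ (K + 1) * (n * W.card) + 2 ^ (K + 1) * n * R.card := by ring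
    _ ≤ 33 * 2 ^ (K + 1) * (16 * ∑ x, (inversions g x).card) + 32 * ∑ x, t x :=
        add_le_add (Nat.mul_le_mul_left _ hW1) hRt
    _ = _ := by ring

end Line
/-! ### Uniform probabilities on finite types -/

section Probability

open scoped BigOperators

open scoped Classical in
/-- The probability of an event under the uniform distribution on a finite type. -/
noncomputable def prob {Ω : Type*} [Fintype Ω] (p : Ω → Prop) : ℝ :=
  𝔼 ω, if p ω then 1 else 0

variable {Ω Ω' : Type*} [Fintype Ω] [Fintype Ω']

lemma prob_eq_card_div (p : Ω → Prop) [DecidablePred p] :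
    prob p = (Finset.univ.filter p).card / (Fintype.card Ω : ℝ) := by
  rw [prob, Fintype.expect_eq_sum_div_card, Finset.card_filter]
  push_cast
  congr 1
  refine Finset.sum_congr rfl fun x _ => ?_
  by_cases h : p x <;> simp [h]

lemma prob_eq_expect (p : Ω → Prop) [DecidablePred p] : prob p = 𝔼 ω, if p ω then 1 else 0 := by
  rw [prob]
  refine Finset.expect_congr rfl fun x _ => ?_
  by_cases h : p x <;> simp [h]

lemma prob_nonneg (p : Ω → Prop) : 0 ≤ prob p := by
  classical
  rw [prob_eq_card_div]; positivity

lemma prob_mono {p q : Ω → Prop} (h : ∀ ω, p ω → q ω) : prob p ≤ prob q := by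
  classical
  simp only [prob]
  refine Finset.expect_le_expect fun ω _ => ?_
  by_cases hp : p ω
  · simp [hp, h ω hp]
  · simp only [hp, if_false]; split_ifs <;> norm_num

lemma prob_not [Nonempty Ω] (p : Ω → Prop) : prob (fun ω => ¬ p ω) = 1 - prob p := by
  classical
  rw [eq_sub_iff_add_eq]
  simp only [prob]
  rw [← Finset.expect_add_distrib, ← Fintype.expect_one (ι := Ω) (M := ℝ)]
  refine Finset.expect_congr rfl fun ω _ => ?_
  by_cases hp : p ω <;> simp [hp]

lemma prob_le_one [Nonempty Ω] (p : Ω → Prop) : prob p ≤ 1 := by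
  have h1 := prob_not p
  have h2 := prob_nonneg fun ω => ¬ p ω
  linarith

lemma prob_or_le (p q : Ω → Prop) : prob (fun ω => p ω ∨ q ω) ≤ prob p + prob q := by
  classical
  simp only [prob]
  rw [← Finset.expect_add_distrib]
  refine Finset.expect_le_expect fun ω _ => ?_
  by_cases hp : p ω <;> by_cases hq : q ω <;> simp [hp, hq]

lemma expect_prod (F : Ω × Ω' → ℝ) : 𝔼 x, F x = 𝔼 a, 𝔼 b, F (a, b) := by
  rw [← Finset.univ_product_univ, Finset.expect_product]

lemma prob_prod (p : Ω × Ω' → Prop) : prob p = 𝔼 a, prob fun b => p (a, b) := by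
  simp only [prob]
  exact expect_prod _

lemma prob_and_prod (p : Ω → Prop) (q : Ω' → Prop) :
    prob (fun x : Ω × Ω' => p x.1 ∧ q x.2) = prob p * prob q := by
  classical
  rw [prob_prod, prob, Finset.expect_mul]
  refine Finset.expect_congr rfl fun a _ => ?_
  by_cases hp : p a <;> simp [hp, prob]

lemma prob_fst [Nonempty Ω'] (p : Ω → Prop) : prob (fun x : Ω × Ω' => p x.1) = prob p := by
  rw [prob_prod]
  refine Finset.expect_congr rfl fun a _ => ?_
  by_cases h : p a <;> simp [prob, h]

lemma prob_snd [Nonempty Ω] (p : Ω' → Prop) : prob (fun x : Ω × Ω' => p x.2) = prob p := by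
  rw [prob_prod]
  simp only [Fintype.expect_const]

lemma prob_forall {ι : Type*} [Fintype ι] [DecidableEq ι] {Ω : ι → Type*} [∀ i, Fintype (Ω i)]
    (p : ∀ i, Ω i → Prop) :
    prob (fun ω : ∀ i, Ω i => ∀ i, p i (ω i)) = ∏ i, prob (p i) := by
  classical
  simp only [prob_eq_card_div]
  rw [Finset.prod_div_distrib, Fintype.card_pi]
  push_cast
  congr 1
  rw [← Nat.cast_prod, ← Fintype.card_piFinset]
  congr 2
  ext ω
  simp

/-- Markov's inequality. -/
lemma prob_lt_le {X : Ω → ℝ} (hX : ∀ ω, 0 ≤ X ω) {c : ℝ} (hc : 0 < c) :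
    prob (fun ω => c < X ω) ≤ (𝔼 ω, X ω) / c := by
  classical
  simp only [prob]
  rw [Finset.expect_div]
  refine Finset.expect_le_expect fun ω _ => ?_
  split_ifs with h
  · rw [one_le_div hc]; exact h.le
  · have := hX ω; positivity

lemma expect_pi_apply {ι : Type*} [Fintype ι] [DecidableEq ι] [Nonempty Ω] (i : ι) (F : Ω → ℝ) :
    𝔼 ω : ι → Ω, F (ω i) = 𝔼 a, F a := by
  rw [Fintype.expect_equiv (Equiv.funSplitAt i Ω) (fun ω => F (ω i)) (fun x => F x.1)
    (fun ω => by simp), expect_prod]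
  simp only [Fintype.expect_const]

lemma expect_fin_succ {M : ℕ} (F : (Fin (M + 1) → Ω) → ℝ) :
    𝔼 ω, F ω = 𝔼 a, 𝔼 t, F (Fin.cons a t) := by
  rw [← expect_prod fun x : Ω × (Fin M → Ω) => F (Fin.cons x.1 x.2)]
  exact (Fintype.expect_equiv (Fin.consEquiv fun _ : Fin (M + 1) => Ω) _ _ fun _ => rfl).symm

end Probability

/-! ### Averaging over the lines of the hypergrid -/

section Lines

open scoped BigOperators

variable {n d : ℕ}

/-- The restriction of `f` to the line through `x` in direction `i`. -/
def lineFn (f : Hypergrid n d → ℝ) (i : Fin d) (x : Hypergrid n d) : Fin n → ℝ :=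
  fun a => f (Function.update x i a)

/-- Replacing the `i`-th coordinate of a uniform point by an independent uniform value gives a
uniform point. -/
lemma expect_update (i : Fin d) (F : Hypergrid n d → ℝ) :
    𝔼 x, F x = 𝔼 x : Hypergrid n d, 𝔼 a : Fin n, F (Function.update x i a) := by
  rcases Nat.eq_zero_or_pos n with rfl | hn
  · have : IsEmpty (Hypergrid 0 d) := ⟨fun x => (x i).elim0⟩
    simp
  have : Nonempty (Fin n) := ⟨⟨0, hn⟩⟩
  have hinv : Function.Involutive fun p : Hypergrid n d × Fin n =>
      (Function.update p.1 i p.2, p.1 i) := fun p => by simp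
  have h1 : 𝔼 x, F x = 𝔼 p : Hypergrid n d × Fin n, F p.1 := by
    rw [expect_prod]
    simp only [Fintype.expect_const]
  rw [h1, ← expect_prod fun p : Hypergrid n d × Fin n => F (Function.update p.1 i p.2)]
  exact (Fintype.expect_equiv hinv.toPerm _ _ fun _ => rfl).symm

/-- The randomness used to query one line of a given direction: a point `x`, which determines the
line and the centre of the probes, the offset of the probes, and the far point. -/
abbrev Seed (n d K : ℕ) : Type := Hypergrid n d × Fin (2 ^ (K + 1)) × Fin n

/-- The sample taken with seed `s` on a line of direction `i` contains a decrease of `f`. -/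
def SeesDecrease {K : ℕ} (f : Hypergrid n d → ℝ) (i : Fin d) (s : Seed n d K) : Prop :=
  HasDecrease (lineFn f i s.1) (lineSample K (s.1 i) s.2.1 s.2.2)

/-- The sample taken with seed `s` on a line of direction `i` contains an increase of `f`. -/
def SeesIncrease {K : ℕ} (f : Hypergrid n d → ℝ) (i : Fin d) (s : Seed n d K) : Prop :=
  HasIncrease (lineFn f i s.1) (lineSample K (s.1 i) s.2.1 s.2.2)

/-- The points that are locally bad for monotonicity on their line of direction `i`. -/
noncomputable def badPoints (K : ℕ) (f : Hypergrid n d → ℝ) (i : Fin d) :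
    Finset (Hypergrid n d) :=
  Finset.univ.filter fun x => x i ∈ locallyBad K (lineFn f i x)

lemma mem_badPoints {K : ℕ} {f : Hypergrid n d → ℝ} {i : Fin d} {x : Hypergrid n d} :
    x ∈ badPoints K f i ↔ x i ∈ locallyBad K (lineFn f i x) := by
  simp [badPoints]

lemma le_of_notMem_badPoints {K : ℕ} (hK : n ≤ 2 ^ K) (f : Hypergrid n d → ℝ) (i : Fin d)
    {x : Hypergrid n d} {c : Fin n} (hc : x i ≤ c) (hx : x ∉ badPoints K f i)
    (hxc : Function.update x i c ∉ badPoints K f i) : f x ≤ f (Function.update x i c) := by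
  rw [mem_badPoints] at hx hxc
  have h : lineFn f i (Function.update x i c) = lineFn f i x := by
    funext a; simp [lineFn]
  rw [h, Function.update_self] at hxc
  simpa [lineFn] using le_of_notMem_locallyBad hK _ hc hx hxc

lemma prob_badPoints_le_seesDecrease (K : ℕ) (f : Hypergrid n d → ℝ) (i : Fin d) :
    prob (fun x => x ∈ badPoints K f i) ≤ 8 * prob (SeesDecrease (K := K) f i) := by
  classical
  rcases Nat.eq_zero_or_pos n with rfl | hn
  · have : IsEmpty (Hypergrid 0 d) := ⟨fun x => (x i).elim0⟩
    simp [prob]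
  have : Nonempty (Fin n) := ⟨⟨0, hn⟩⟩
  rw [prob_prod, Finset.mul_expect, prob]
  refine Finset.expect_le_expect fun x _ => ?_
  split_ifs with hx
  swap
  · exact mul_nonneg (by norm_num) (prob_nonneg _)
  simp only [prob]
  rw [expect_prod, Finset.expect_comm, Finset.mul_expect]
  refine (Fintype.expect_const (ι := Fin n) (1 : ℝ)).symm.le.trans ?_
  refine Finset.expect_le_expect fun z _ => ?_
  have h := le_card_hasDecrease (mem_badPoints.1 hx) z
    (fun r : Fin (2 ^ (K + 1)) => SeesDecrease f i (x, r, z)) (fun r hr => hr)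
  have h2 := prob_eq_card_div (fun r : Fin (2 ^ (K + 1)) => SeesDecrease f i (x, r, z))
  simp only [prob] at h2
  rw [h2, Fintype.card_fin, ← mul_div_assoc, one_le_div (by positivity)]
  exact_mod_cast h

lemma hasDecrease_pair {g : Fin n → ℝ} {x y : Fin n} :
    HasDecrease g [x, y] ↔ Inverted g x y := by
  constructor
  · rintro ⟨a, ha, b, hb, h1, h2⟩
    simp only [List.mem_cons, List.not_mem_nil, or_false] at ha hb
    rcases ha with rfl | rfl <;> rcases hb with rfl | rfl
    · exact absurd h1 (lt_irrefl _)
    · exact Or.inl ⟨h1, h2⟩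
    · exact Or.inr ⟨h1, h2⟩
    · exact absurd h1 (lt_irrefl _)
  · intro h
    exact h.hasDecrease (by simp) (by simp)

/-- Two uniform points of a uniform line of direction `i` form a decrease of `f`. -/
def PairDecrease (f : Hypergrid n d → ℝ) (i : Fin d) (p : Hypergrid n d × Fin n) : Prop :=
  HasDecrease (lineFn f i p.1) [p.1 i, p.2]

/-- Two uniform points of a uniform line of direction `i` form an increase of `f`. -/
def PairIncrease (f : Hypergrid n d → ℝ) (i : Fin d) (p : Hypergrid n d × Fin n) : Prop :=
  HasIncrease (lineFn f i p.1) [p.1 i, p.2]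

/-- The average of `card_locallyBad_le` over all lines of direction `i`. -/
lemma prob_badPoints_le (K : ℕ) (f : Hypergrid n d → ℝ) (i : Fin d) :
    prob (fun x => x ∈ badPoints K f i) ≤ 528 * prob (PairDecrease f i) +
      32 * prob (fun s : Seed n d K => SeesDecrease f i s ∧ SeesIncrease f i s) := by
  classical
  rcases Nat.eq_zero_or_pos n with rfl | hn
  · have : IsEmpty (Hypergrid 0 d) := ⟨fun x => (x i).elim0⟩
    simp [prob]
  have hline : ∀ (x : Hypergrid n d) a, lineFn f i (Function.update x i a) = lineFn f i x :=
    fun x a => by funext b; simp [lineFn]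
  rw [prob, expect_update i, prob_prod (PairDecrease f i), prob_prod,
    expect_update i (fun x => prob fun z => PairDecrease f i (x, z)),
    expect_update i (fun x => prob fun s => SeesDecrease f i (x, s) ∧ SeesIncrease f i (x, s)),
    Finset.mul_expect, Finset.mul_expect, ← Finset.expect_add_distrib]
  refine Finset.expect_le_expect fun x _ => ?_
  simp only [mem_badPoints, PairDecrease, SeesDecrease, SeesIncrease, hline, Function.update_self,
    hasDecrease_pair]
  have h := card_locallyBad_le K (lineFn f i x)
  have hn' : (0 : ℝ) < n := by exact_mod_cast hn
  have e1 : (𝔼 a : Fin n, if a ∈ locallyBad K (lineFn f i x) then (1 : ℝ) else 0) =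
      (locallyBad K (lineFn f i x)).card / n := by
    rw [Fintype.expect_eq_sum_div_card, Finset.sum_boole, Fintype.card_fin]
    simp
  have e2 : (𝔼 a : Fin n, prob fun z : Fin n => Inverted (lineFn f i x) a z) =
      (∑ a, ((inversions (lineFn f i x) a).card : ℝ)) / (n * n) := by
    simp only [prob_eq_card_div, Fintype.expect_eq_sum_div_card, Fintype.card_fin, inversions]
    rw [← Finset.sum_div, div_div]
  have e3 : (𝔼 a : Fin n, prob fun s : Fin (2 ^ (K + 1)) × Fin n =>
        HasDecrease (lineFn f i x) (lineSample K a s.1 s.2) ∧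
        HasIncrease (lineFn f i x) (lineSample K a s.1 s.2)) =
      (∑ a, ((Finset.univ.filter fun p : Fin (2 ^ (K + 1)) × Fin n =>
        HasDecrease (lineFn f i x) (lineSample K a p.1 p.2) ∧
        HasIncrease (lineFn f i x) (lineSample K a p.1 p.2)).card : ℝ)) /
        (2 ^ (K + 1) * n * n) := by
    simp only [prob_eq_card_div, Fintype.expect_eq_sum_div_card, Fintype.card_fin,
      Fintype.card_prod]
    rw [← Finset.sum_div, div_div]
    push_cast
    rfl
  rw [e1, e2, e3]
  rify at h
  rw [mul_div_assoc', mul_div_assoc', div_add_div _ _ (by positivity) (by positivity),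
    div_le_div_iff₀ (by positivity) (by positivity)]
  have := mul_le_mul_of_nonneg_left h (show (0 : ℝ) ≤ n * n * n by positivity)
  linarith

lemma lineFn_neg (f : Hypergrid n d → ℝ) (i : Fin d) (x : Hypergrid n d) :
    lineFn (fun y => -f y) i x = fun a => -lineFn f i x a := rfl

/-- The quantity to which both testers are sensitive: if `f` is far from unate, then the sum over
the directions of the smaller of the densities of the two kinds of bad points is large. -/
lemma le_sum_min_prob_badPoints {K : ℕ} (hn : 1 ≤ n) (hK : n ≤ 2 ^ K) {f : Hypergrid n d → ℝ}
    {ε : ℝ} (hf : IsFar (Unate n d) ε f) :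
    ε ≤ 12 * ∑ i, min (prob fun x => x ∈ badPoints K f i)
      (prob fun x => x ∈ badPoints K (fun y => -f y) i) := by
  classical
  have : Nonempty (Fin n) := ⟨⟨0, hn⟩⟩
  let b : Fin d → Bool := fun i => decide ((prob fun x => x ∈ badPoints K f i) ≤
    (prob fun x => x ∈ badPoints K (fun y => -f y) i))
  let S : Fin d → Finset (Hypergrid n d) := fun i =>
    if b i then badPoints K f i else badPoints K (fun y => -f y) i
  obtain ⟨g, hg, hd⟩ := exists_unate_hammingDist_le f b S (by
    intro i x hx c hc hxc
    by_cases hb : b i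
    · simp only [S, hb, if_true] at hx hxc ⊢
      exact le_of_notMem_badPoints hK f i hc hx hxc
    · simp only [S, hb] at hx hxc ⊢
      have := le_of_notMem_badPoints hK _ i hc hx hxc
      simpa using this)
  have h1 := hf g hg
  have hX : (0 : ℝ) < Fintype.card (Hypergrid n d) := by exact_mod_cast Fintype.card_pos
  have hd : (hammingDist f g : ℝ) ≤ 12 * ∑ i, ((S i).card : ℝ) := by exact_mod_cast hd
  have h2 : ∀ i, min (prob fun x => x ∈ badPoints K f i)
      (prob fun x => x ∈ badPoints K (fun y => -f y) i) =
      (S i).card / (Fintype.card (Hypergrid n d) : ℝ) := by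
    intro i
    by_cases hb : b i
    · have := of_decide_eq_true hb
      rw [min_eq_left this, prob_eq_card_div]
      simp [S, hb]
    · have := of_decide_eq_false (Bool.eq_false_iff.2 hb)
      rw [min_eq_right (not_le.1 this).le, prob_eq_card_div]
      simp [S, hb]
  simp only [h2]
  rw [← Finset.sum_div, ← mul_div_assoc, le_div_iff₀ hX]
  exact h1.trans hd

lemma seesDecrease_neg {K : ℕ} (f : Hypergrid n d → ℝ) (i : Fin d) :
    SeesDecrease (K := K) (fun y => -f y) i = SeesIncrease f i := by
  funext s
  simp only [SeesDecrease, SeesIncrease, lineFn_neg, hasDecrease_neg]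

lemma seesIncrease_neg {K : ℕ} (f : Hypergrid n d → ℝ) (i : Fin d) :
    SeesIncrease (K := K) (fun y => -f y) i = SeesDecrease f i := by
  funext s
  simp only [SeesDecrease, SeesIncrease, lineFn_neg, hasIncrease_neg]

lemma pairDecrease_neg (f : Hypergrid n d → ℝ) (i : Fin d) :
    PairDecrease (fun y => -f y) i = PairIncrease f i := by
  funext s
  simp only [PairDecrease, PairIncrease, lineFn_neg, hasDecrease_neg]

/-- Line samples detect functions that are far from unate, if the decrease and the increase may
come from independent samples in the same direction. -/
theorem le_sum_min_prob_sees {K : ℕ} (hn : 1 ≤ n) (hK : n ≤ 2 ^ K) {f : Hypergrid n d → ℝ}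
    {ε : ℝ} (hf : IsFar (Unate n d) ε f) :
    ε ≤ 96 * ∑ i, min (prob (SeesDecrease (K := K) f i)) (prob (SeesIncrease (K := K) f i)) := by
  refine (le_sum_min_prob_badPoints hn hK hf).trans ?_
  rw [show (96 : ℝ) = 12 * 8 by norm_num, mul_assoc, Finset.mul_sum (a := (8 : ℝ))]
  refine mul_le_mul_of_nonneg_left (Finset.sum_le_sum fun i _ => ?_) (by norm_num)
  rw [mul_min_of_nonneg _ _ (by norm_num : (0 : ℝ) ≤ 8)]
  refine min_le_min (prob_badPoints_le_seesDecrease K f i) ?_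
  have := prob_badPoints_le_seesDecrease K (fun y => -f y) i
  rwa [seesDecrease_neg] at this

/-- For functions that are far from unate, either single line samples contain both a decrease and
an increase, or pairs of uniform points of lines detect both. -/
theorem le_sum_min_prob_pair {K : ℕ} (hn : 1 ≤ n) (hK : n ≤ 2 ^ K) {f : Hypergrid n d → ℝ}
    {ε : ℝ} (hf : IsFar (Unate n d) ε f) :
    ε ≤ 12 * (528 * ∑ i, min (prob (PairDecrease f i)) (prob (PairIncrease f i)) +
      32 * ∑ i, prob (fun s : Seed n d K => SeesDecrease f i s ∧ SeesIncrease f i s)) := by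
  refine (le_sum_min_prob_badPoints hn hK hf).trans ?_
  rw [Finset.mul_sum (a := (528 : ℝ)), Finset.mul_sum (a := (32 : ℝ)), ← Finset.sum_add_distrib]
  refine mul_le_mul_of_nonneg_left (Finset.sum_le_sum fun i _ => ?_) (by norm_num)
  rw [mul_min_of_nonneg _ _ (by norm_num : (0 : ℝ) ≤ 528), ← min_add_add_right]
  refine min_le_min (prob_badPoints_le K f i) ?_
  have := prob_badPoints_le K (fun y => -f y) i
  simp only [pairDecrease_neg, seesDecrease_neg, seesIncrease_neg] at this
  simpa only [and_comm] using this

end Lines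
/-! ### Combinators for query algorithms -/

section QueryAlgorithms

open scoped Classical

variable {X : Type}

/-- Query all points of a list, then continue knowing the values at these points (presented as a
function that vanishes at the points that were not queried). -/
noncomputable def QueryAlg.ask : List X → ((X → ℝ) → QueryAlg X) → QueryAlg X
  | [], k => k fun _ => 0
  | x :: l, k => .query x fun a => QueryAlg.ask l fun g => k (Function.update g x a)

/-- The function that agrees with `f` on the points of `l` and vanishes elsewhere. -/
noncomputable def restrictTo (l : List X) (f : X → ℝ) : X → ℝ :=
  fun x => if x ∈ l then f x else 0

lemma restrictTo_nil (f : X → ℝ) : restrictTo [] f = fun _ => 0 := by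
  funext x
  simp [restrictTo]

lemma update_restrictTo (l : List X) (f : X → ℝ) (x : X) :
    Function.update (restrictTo l f) x (f x) = restrictTo (x :: l) f := by
  funext y
  by_cases h : y = x
  · subst h; simp [restrictTo]
  · simp [restrictTo, h]

lemma QueryAlg.run_ask : ∀ (l : List X) (k : (X → ℝ) → QueryAlg X) (f : X → ℝ),
    (QueryAlg.ask l k).run f = (k (restrictTo l f)).run f
  | [], k, f => by simp [QueryAlg.ask, restrictTo_nil]
  | x :: l, k, f => by
    rw [QueryAlg.ask, QueryAlg.run, QueryAlg.run_ask l, update_restrictTo]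

lemma QueryAlg.queries_ask : ∀ (l : List X) (k : (X → ℝ) → QueryAlg X) (f : X → ℝ),
    (QueryAlg.ask l k).queries f = l ++ (k (restrictTo l f)).queries f
  | [], k, f => by simp [QueryAlg.ask, restrictTo_nil]
  | x :: l, k, f => by
    rw [QueryAlg.ask, QueryAlg.queries, QueryAlg.queries_ask l, update_restrictTo]
    rfl

/-- Run `T₁`; reject if it rejects, and run `T₂` if it accepts. -/
def QueryAlg.andThen : QueryAlg X → QueryAlg X → QueryAlg X
  | .output v, T₂ => if v then T₂ else .output false
  | .query x next, T₂ => .query x fun a => (next a).andThen T₂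

lemma QueryAlg.run_andThen (T₂ : QueryAlg X) (f : X → ℝ) : ∀ T₁ : QueryAlg X,
    (T₁.andThen T₂).run f = (T₁.run f && T₂.run f)
  | .output v => by cases v <;> simp [QueryAlg.andThen, QueryAlg.run]
  | .query x next => by
    simp only [QueryAlg.andThen, QueryAlg.run]
    exact QueryAlg.run_andThen T₂ f (next (f x))

lemma QueryAlg.length_queries_andThen_le (T₂ : QueryAlg X) (f : X → ℝ) : ∀ T₁ : QueryAlg X,
    ((T₁.andThen T₂).queries f).length ≤ (T₁.queries f).length + (T₂.queries f).length
  | .output v => by cases v <;> simp [QueryAlg.andThen, QueryAlg.queries]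
  | .query x next => by
    simp only [QueryAlg.andThen, QueryAlg.queries, List.length_cons]
    have := QueryAlg.length_queries_andThen_le T₂ f (next (f x))
    omega

/-- Run a list of algorithms and reject as soon as one of them rejects. -/
def QueryAlg.all : List (QueryAlg X) → QueryAlg X
  | [] => .output true
  | T :: l => T.andThen (QueryAlg.all l)

lemma QueryAlg.run_all_eq_false_iff {f : X → ℝ} : ∀ {l : List (QueryAlg X)},
    (QueryAlg.all l).run f = false ↔ ∃ T ∈ l, T.run f = false
  | [] => by simp [QueryAlg.all, QueryAlg.run]
  | T :: l => by
    simp only [QueryAlg.all, QueryAlg.run_andThen, Bool.and_eq_false_iff,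
      QueryAlg.run_all_eq_false_iff (l := l), List.mem_cons, exists_eq_or_imp]

lemma QueryAlg.length_queries_all_le (f : X → ℝ) : ∀ l : List (QueryAlg X),
    ((QueryAlg.all l).queries f).length ≤ (l.map fun T => (T.queries f).length).sum
  | [] => by simp [QueryAlg.all, QueryAlg.queries]
  | T :: l => by
    have h1 := QueryAlg.length_queries_andThen_le (QueryAlg.all l) f T
    have h2 := QueryAlg.length_queries_all_le f l
    simp only [QueryAlg.all, List.map_cons, List.sum_cons]
    omega

/-- Run the algorithm with a budget of `b` queries; accept if the budget is exceeded. -/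
def QueryAlg.truncate : ℕ → QueryAlg X → QueryAlg X
  | _, .output v => .output v
  | 0, .query _ _ => .output true
  | b + 1, .query x next => .query x fun a => (next a).truncate b

lemma QueryAlg.length_queries_truncate_le (f : X → ℝ) : ∀ (b : ℕ) (T : QueryAlg X),
    ((T.truncate b).queries f).length ≤ b
  | _, .output v => by simp [QueryAlg.truncate, QueryAlg.queries]
  | 0, .query _ _ => by simp [QueryAlg.truncate, QueryAlg.queries]
  | b + 1, .query x next => by
    simp only [QueryAlg.truncate, QueryAlg.queries, List.length_cons]
    have := QueryAlg.length_queries_truncate_le f b (next (f x))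
    omega

lemma QueryAlg.run_truncate_of_le (f : X → ℝ) : ∀ (b : ℕ) (T : QueryAlg X),
    (T.queries f).length ≤ b → (T.truncate b).run f = T.run f
  | _, .output v, _ => by simp [QueryAlg.truncate]
  | 0, .query _ _, h => by simp [QueryAlg.queries] at h
  | b + 1, .query x next, h => by
    simp only [QueryAlg.queries, List.length_cons] at h
    simp only [QueryAlg.truncate, QueryAlg.run]
    exact QueryAlg.run_truncate_of_le f b (next (f x)) (by omega)

lemma QueryAlg.run_truncate_of_run (f : X → ℝ) : ∀ (b : ℕ) (T : QueryAlg X),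
    T.run f = true → (T.truncate b).run f = true
  | _, .output v, h => by simpa [QueryAlg.truncate] using h
  | 0, .query _ _, _ => by simp [QueryAlg.truncate, QueryAlg.run]
  | b + 1, .query x next, h => by
    simp only [QueryAlg.truncate, QueryAlg.run] at h ⊢
    exact QueryAlg.run_truncate_of_run f b (next (f x)) h

/-- The randomized algorithm that draws a uniform seed and runs the corresponding deterministic
algorithm. -/
noncomputable def ofSeed {Ω : Type} [Fintype Ω] [Nonempty Ω] (T : Ω → QueryAlg X) : RandAlg X :=
  (PMF.uniformOfFintype Ω).map T

variable {Ω : Type} [Fintype Ω] [Nonempty Ω]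

lemma mem_support_ofSeed {T : Ω → QueryAlg X} {S : QueryAlg X} :
    S ∈ (ofSeed T).support ↔ ∃ ω, T ω = S := by
  simp [ofSeed]

lemma map_run_ofSeed_apply (T : Ω → QueryAlg X) (f : X → ℝ) (b : Bool) :
    ((ofSeed T).map fun S => S.run f) b = ENNReal.ofReal (prob fun ω => (T ω).run f = b) := by
  rw [ofSeed, PMF.map_comp, PMF.map_apply, tsum_fintype, prob_eq_card_div,
    ENNReal.ofReal_div_of_pos (by exact_mod_cast Fintype.card_pos), ENNReal.ofReal_natCast,
    ENNReal.ofReal_natCast, Finset.card_filter, ENNReal.div_eq_inv_mul]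
  push_cast
  rw [Finset.mul_sum]
  refine Finset.sum_congr rfl fun ω _ => ?_
  by_cases h : (T ω).run f = b
  · simp [h, PMF.uniformOfFintype_apply]
  · simp [h, Ne.symm h]

lemma isTester_ofSeed [Fintype X] {P : Set (X → ℝ)} {ε : ℝ} {T : Ω → QueryAlg X}
    (hacc : ∀ f ∈ P, ∀ ω, (T ω).run f = true)
    (hrej : ∀ f, IsFar P ε f → 2 / 3 ≤ prob fun ω => (T ω).run f = false) :
    IsTester P ε (ofSeed T) ∧ HasOneSidedError P (ofSeed T) := by
  have h23 : (2 / 3 : ENNReal) = ENNReal.ofReal (2 / 3) := by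
    rw [ENNReal.ofReal_div_of_pos (by norm_num)]; simp
  refine ⟨⟨fun f hf => ?_, fun f hf => ?_⟩, fun f hf S hS => ?_⟩
  · rw [acceptProb, map_run_ofSeed_apply, h23]
    refine ENNReal.ofReal_le_ofReal ?_
    simp only [hacc f hf, prob, if_true]
    rw [Fintype.expect_const]
    norm_num
  · rw [rejectProb, map_run_ofSeed_apply, h23]
    exact ENNReal.ofReal_le_ofReal (hrej f hf)
  · obtain ⟨ω, rfl⟩ := mem_support_ofSeed.1 hS
    exact hacc f hf ω

end QueryAlgorithms

/-! ### Evidence against unateness -/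

section Evidence

variable {n d : ℕ}

/-- The points queried on a line of direction `i` with seed `s`. -/
def seedPoints {K : ℕ} (i : Fin d) (s : Seed n d K) : List (Hypergrid n d) :=
  (lineSample K (s.1 i) s.2.1 s.2.2).map fun a => Function.update s.1 i a

lemma length_seedPoints {K : ℕ} (i : Fin d) (s : Seed n d K) :
    (seedPoints i s).length = K + 3 := by
  simp [seedPoints, length_lineSample]

lemma hasDecrease_congr {g g' : Fin n → ℝ} {Q : List (Fin n)} (h : ∀ a ∈ Q, g a = g' a) :
    HasDecrease g Q ↔ HasDecrease g' Q := by
  simp only [HasDecrease]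
  constructor
  · rintro ⟨a, ha, b, hb, h1, h2⟩
    exact ⟨a, ha, b, hb, h1, by rwa [← h a ha, ← h b hb]⟩
  · rintro ⟨a, ha, b, hb, h1, h2⟩
    exact ⟨a, ha, b, hb, h1, by rwa [h a ha, h b hb]⟩

lemma hasIncrease_congr {g g' : Fin n → ℝ} {Q : List (Fin n)} (h : ∀ a ∈ Q, g a = g' a) :
    HasIncrease g Q ↔ HasIncrease g' Q := by
  rw [← hasDecrease_neg, ← hasDecrease_neg]
  exact hasDecrease_congr fun a ha => by rw [h a ha]

lemma seesDecrease_restrictTo {K : ℕ} (f : Hypergrid n d → ℝ) (i : Fin d) (s : Seed n d K) :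
    SeesDecrease (restrictTo (seedPoints i s) f) i s ↔ SeesDecrease f i s :=
  hasDecrease_congr fun a ha => if_pos (List.mem_map.2 ⟨a, ha, rfl⟩)

lemma seesIncrease_restrictTo {K : ℕ} (f : Hypergrid n d → ℝ) (i : Fin d) (s : Seed n d K) :
    SeesIncrease (restrictTo (seedPoints i s) f) i s ↔ SeesIncrease f i s :=
  hasIncrease_congr fun a ha => if_pos (List.mem_map.2 ⟨a, ha, rfl⟩)

lemma not_hasIncrease_of_hasDecrease {f : Hypergrid n d → ℝ} (hf : f ∈ Unate n d) {i : Fin d}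
    {x y : Hypergrid n d} {Q Q' : List (Fin n)} (hd : HasDecrease (lineFn f i x) Q) :
    ¬ HasIncrease (lineFn f i y) Q' := by
  rintro ⟨a, -, b, -, hab, h⟩
  obtain ⟨a', -, b', -, hab', h'⟩ := hd
  rcases hf i with hm | hm
  · exact absurd (hm x hab'.le) (not_le.2 h')
  · exact absurd (hm y hab.le) (not_le.2 h)

end Evidence

/-! ### Waiting for a flagged sample -/

section Waiting

open scoped Classical BigOperators

variable {Ω : Type*}

/-- The first element of the list with property `q` also has property `p` (in particular there is
such an element). -/
def FirstSatisfies (q p : Ω → Prop) : List Ω → Prop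
  | [] => False
  | s :: l => (q s ∧ p s) ∨ (¬ q s ∧ FirstSatisfies q p l)

/-- The number of elements of the list that are read until one with property `q` is found. -/
noncomputable def waitingTime (q : Ω → Prop) : List Ω → ℕ
  | [] => 0
  | s :: l => 1 + if q s then 0 else waitingTime q l

lemma FirstSatisfies.mono {q p p' : Ω → Prop} (h : ∀ s, p s → p' s) :
    ∀ {l : List Ω}, FirstSatisfies q p l → FirstSatisfies q p' l
  | [], h0 => h0
  | _ :: _, Or.inl h0 => Or.inl ⟨h0.1, h _ h0.2⟩
  | _ :: _, Or.inr h0 => Or.inr ⟨h0.1, h0.2.mono h⟩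

variable [Fintype Ω]

lemma prob_mul_geom_sum (q : Ω → Prop) (M : ℕ) :
    prob q * ∑ j ∈ Finset.range M, (1 - prob q) ^ j = 1 - (1 - prob q) ^ M := by
  have := mul_neg_geom_sum (1 - prob q) M
  rwa [sub_sub_cancel] at this

variable [Nonempty Ω]

lemma expect_waitingTime (q : Ω → Prop) (M : ℕ) :
    𝔼 t : Fin M → Ω, (waitingTime q (List.ofFn t) : ℝ) =
      ∑ j ∈ Finset.range M, (1 - prob q) ^ j := by
  induction M with
  | zero => simp [waitingTime]
  | succ M ih =>
    rw [expect_fin_succ, Finset.sum_range_succ', pow_zero, add_comm _ (1 : ℝ)]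
    have h : ∀ a : Ω, (𝔼 t : Fin M → Ω,
        (waitingTime q (List.ofFn (Fin.cons a t : Fin (M + 1) → Ω)) : ℝ)) = 1 + (if ¬ q a then 1 else 0) * ∑ j ∈ Finset.range M, (1 - prob q) ^ j := by
      intro a
      rw [← ih]
      simp only [List.ofFn_succ, Fin.cons_zero, Fin.cons_succ, waitingTime]
      push_cast
      rw [Finset.expect_add_distrib, Fintype.expect_const]
      by_cases hq : q a <;> simp [hq]
    simp only [h]
    rw [Finset.expect_add_distrib, Fintype.expect_const, ← Finset.expect_mul]
    congr 1
    rw [← prob_eq_expect fun a => ¬ q a, ← prob_not,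
      Finset.sum_congr rfl fun j _ => pow_succ' _ j, ← Finset.mul_sum]

lemma prob_firstSatisfies (q p : Ω → Prop) (hpq : ∀ s, p s → q s) (M : ℕ) :
    prob (fun t : Fin M → Ω => FirstSatisfies q p (List.ofFn t)) =
      prob p * ∑ j ∈ Finset.range M, (1 - prob q) ^ j := by
  induction M with
  | zero => simp [FirstSatisfies, prob]
  | succ M ih =>
    rw [prob, expect_fin_succ, Finset.sum_range_succ', pow_zero, mul_add, mul_one,
      add_comm _ (prob p)]
    have h : ∀ a : Ω, (𝔼 t : Fin M → Ω,
        if FirstSatisfies q p (List.ofFn (Fin.cons a t : Fin (M + 1) → Ω)) then (1 : ℝ) else 0) =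
        (if p a then 1 else 0) + (if ¬ q a then 1 else 0) *
          (prob p * ∑ j ∈ Finset.range M, (1 - prob q) ^ j) := by
      intro a
      rw [← ih]
      simp only [List.ofFn_succ, Fin.cons_zero, Fin.cons_succ, FirstSatisfies]
      by_cases hp : p a
      · simp [hp, hpq a hp]
      · by_cases hq : q a <;> simp [hp, hq, prob]
    simp only [h]
    rw [Finset.expect_add_distrib, ← Finset.expect_mul, ← prob_eq_expect p]
    congr 1
    rw [← prob_eq_expect fun a => ¬ q a, ← prob_not, mul_left_comm,
      Finset.sum_congr rfl fun j _ => pow_succ' _ j, ← Finset.mul_sum]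

lemma one_sub_pow_le_exp {x : ℝ} (hx : x ≤ 1) (N : ℕ) : (1 - x) ^ N ≤ Real.exp (-(N * x)) := by
  rw [show -((N : ℝ) * x) = N * (-x) by ring, Real.exp_nat_mul]
  exact pow_le_pow_left₀ (by linarith) (by linarith [Real.add_one_le_exp (-x)]) N

lemma exp_neg_one_le : Real.exp (-1) ≤ 3 / 8 := by
  rw [Real.exp_neg, inv_le_comm₀ (Real.exp_pos _) (by norm_num)]
  linarith [Real.exp_one_gt_d9]

lemma exp_neg_two_lt_sixth : Real.exp (-2) < 1 / 6 := by
  have h : Real.exp 2 = Real.exp 1 * Real.exp 1 := by rw [← Real.exp_add]; norm_num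
  rw [Real.exp_neg, inv_lt_comm₀ (Real.exp_pos _) (by norm_num), h]
  nlinarith [Real.exp_one_gt_d9]

/-- Read one sample, and, if it is flagged with one of two marks, keep reading until the next
flagged sample. Both marks are then seen with probability at least a quarter of the smaller of
their probabilities: the next flagged sample carries the likelier mark with probability about
one half. -/
lemma le_prob_both_marks (D U : Ω → Prop) {M : ℕ} (hM : 1 ≤ M * min (prob D) (prob U)) :
    min (prob D) (prob U) / 4 ≤ prob fun x : Ω × (Fin M → Ω) =>
      (D x.1 ∨ U x.1) ∧ FirstSatisfies (fun s => D s ∨ U s)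
        (fun s => (D x.1 ∨ D s) ∧ (U x.1 ∨ U s)) (List.ofFn x.2) := by
  have key : ∀ D U : Ω → Prop, prob D ≤ prob U → 1 ≤ M * prob D →
      prob D / 4 ≤ prob fun x : Ω × (Fin M → Ω) =>
      (D x.1 ∨ U x.1) ∧ FirstSatisfies (fun s => D s ∨ U s)
        (fun s => (D x.1 ∨ D s) ∧ (U x.1 ∨ U s)) (List.ofFn x.2) := by
    intro D U hDU hM
    have h1 : prob (fun x : Ω × (Fin M → Ω) => D x.1 ∧
        FirstSatisfies (fun s => D s ∨ U s) U (List.ofFn x.2)) ≤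
        prob fun x : Ω × (Fin M → Ω) => (D x.1 ∨ U x.1) ∧ FirstSatisfies (fun s => D s ∨ U s)
        (fun s => (D x.1 ∨ D s) ∧ (U x.1 ∨ U s)) (List.ofFn x.2) :=
      prob_mono fun x hx => ⟨Or.inl hx.1, hx.2.mono fun s hs => ⟨Or.inl hx.1, Or.inr hs⟩⟩
    refine le_trans ?_ h1
    rw [prob_and_prod D fun t : Fin M → Ω =>
        FirstSatisfies (fun s => D s ∨ U s) U (List.ofFn t), prob_firstSatisfies _ _ fun s hs => Or.inr hs]
    set π := prob fun s => D s ∨ U s with hπ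
    set G := ∑ j ∈ Finset.range M, (1 - π) ^ j with hG
    have h2 : π * G = 1 - (1 - π) ^ M := prob_mul_geom_sum _ M
    have h3 : π ≤ 2 * prob U := by
      have := prob_or_le D U
      linarith
    have h4 : prob D ≤ π := prob_mono fun s hs => Or.inl hs
    have h5 : π ≤ 1 := prob_le_one _
    have h6 : (1 - π) ^ M ≤ 1 / 2 := by
      refine (one_sub_pow_le_exp h5 M).trans (le_trans ?_ (exp_neg_one_le.trans (by norm_num)))
      rw [Real.exp_le_exp]
      have : (M : ℝ) * prob D ≤ M * π := mul_le_mul_of_nonneg_left h4 (by positivity)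
      linarith
    have h7 : 0 ≤ G := Finset.sum_nonneg fun j _ => pow_nonneg (by linarith) j
    have h8 : 1 / 4 ≤ prob U * G := by
      have := mul_le_mul_of_nonneg_right h3 h7
      linarith
    have := mul_le_mul_of_nonneg_left h8 (prob_nonneg D)
    linarith
  rcases le_total (prob D) (prob U) with h | h
  · rw [min_eq_left h] at hM ⊢
    exact key D U h hM
  · rw [min_eq_right h] at hM ⊢
    refine (key U D h hM).trans (prob_mono fun x hx => ?_)
    rw [or_comm]
    refine ⟨hx.1, ?_⟩
    have := hx.2
    simpa only [or_comm, and_comm] using this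

/-- The expected number of samples read is at most two. -/
lemma expect_trial_cost_le (q : Ω → Prop) (M : ℕ) :
    𝔼 x : Ω × (Fin M → Ω),
      (1 + (if q x.1 then (waitingTime q (List.ofFn x.2) : ℝ) else 0)) ≤ 2 := by
  rw [expect_prod]
  have h : ∀ a : Ω, (𝔼 t : Fin M → Ω,
      (1 + (if q a then (waitingTime q (List.ofFn t) : ℝ) else 0))) =
      1 + (if q a then 1 else 0) * ∑ j ∈ Finset.range M, (1 - prob q) ^ j := by
    intro a
    rw [Finset.expect_add_distrib, Fintype.expect_const, ← expect_waitingTime]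
    by_cases hq : q a <;> simp [hq]
  simp only [h]
  rw [Finset.expect_add_distrib, Fintype.expect_const, ← Finset.expect_mul, ← prob_eq_expect q,
    prob_mul_geom_sum]
  have : 0 ≤ (1 - prob q) ^ M := pow_nonneg (by linarith [prob_le_one q]) M
  linarith

end Waiting

/-! ### The adaptive tester -/

section AdaptiveTester

open scoped Classical BigOperators

variable {n d K : ℕ}

/-- The sample taken with seed `s` is not constant. -/
def Flagged (f : Hypergrid n d → ℝ) (i : Fin d) (s : Seed n d K) : Prop :=
  SeesDecrease f i s ∨ SeesIncrease f i s

/-- Sample lines of direction `i` until a nonconstant sample is found, and reject if it provides,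
together with what was known before (a decrease if `D`, an increase if `U`), both a decrease and
an increase. -/
noncomputable def scanAlg (i : Fin d) (D U : Prop) : List (Seed n d K) → QueryAlg (Hypergrid n d)
  | [] => .output true
  | s :: l => .ask (seedPoints i s) fun g =>
      if Flagged g i s then
        .output (decide ¬ ((D ∨ SeesDecrease g i s) ∧ (U ∨ SeesIncrease g i s)))
      else scanAlg i D U l

/-- Sample one line of direction `i`, and if the sample is nonconstant, continue to the next
nonconstant sample. -/
noncomputable def trialAlg (i : Fin d) (s : Seed n d K) (l : List (Seed n d K)) :
    QueryAlg (Hypergrid n d) :=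
  .ask (seedPoints i s) fun g =>
    if Flagged g i s then scanAlg i (SeesDecrease g i s) (SeesIncrease g i s) l else .output true

lemma flagged_restrictTo (f : Hypergrid n d → ℝ) (i : Fin d) (s : Seed n d K) :
    Flagged (restrictTo (seedPoints i s) f) i s ↔ Flagged f i s := by
  simp only [Flagged, seesDecrease_restrictTo, seesIncrease_restrictTo]

lemma run_scanAlg (f : Hypergrid n d → ℝ) (i : Fin d) (D U : Prop) : ∀ l : List (Seed n d K),
    (scanAlg i D U l).run f = false ↔ FirstSatisfies (Flagged f i)
      (fun s => (D ∨ SeesDecrease f i s) ∧ (U ∨ SeesIncrease f i s)) l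
  | [] => by simp [scanAlg, QueryAlg.run, FirstSatisfies]
  | s :: l => by
    simp only [scanAlg, QueryAlg.run_ask, flagged_restrictTo, seesDecrease_restrictTo,
      seesIncrease_restrictTo, FirstSatisfies]
    by_cases h : Flagged f i s
    · simp [h, QueryAlg.run]
      tauto
    · simp only [h, if_false, false_and, not_false_eq_true, true_and, false_or]
      exact run_scanAlg f i D U l

lemma length_queries_scanAlg (f : Hypergrid n d → ℝ) (i : Fin d) (D U : Prop) :
    ∀ l : List (Seed n d K),
    ((scanAlg i D U l).queries f).length = (K + 3) * waitingTime (Flagged f i) l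
  | [] => by simp [scanAlg, QueryAlg.queries, waitingTime]
  | s :: l => by
    simp only [scanAlg, QueryAlg.queries_ask, flagged_restrictTo, waitingTime, List.length_append,
      length_seedPoints]
    by_cases h : Flagged f i s
    · simp [h, QueryAlg.queries]
    · simp only [h, if_false, length_queries_scanAlg f i D U l]
      ring

lemma run_trialAlg (f : Hypergrid n d → ℝ) (i : Fin d) (s : Seed n d K) (l : List (Seed n d K)) :
    (trialAlg i s l).run f = false ↔ Flagged f i s ∧ FirstSatisfies (Flagged f i)
      (fun t => (SeesDecrease f i s ∨ SeesDecrease f i t) ∧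
        (SeesIncrease f i s ∨ SeesIncrease f i t)) l := by
  simp only [trialAlg, QueryAlg.run_ask, flagged_restrictTo, seesDecrease_restrictTo,
    seesIncrease_restrictTo]
  by_cases h : Flagged f i s
  · simp only [h, if_true, true_and, run_scanAlg]
  · simp [h, QueryAlg.run]

lemma length_queries_trialAlg (f : Hypergrid n d → ℝ) (i : Fin d) (s : Seed n d K)
    (l : List (Seed n d K)) :
    ((trialAlg i s l).queries f).length =
      (K + 3) * (1 + if Flagged f i s then waitingTime (Flagged f i) l else 0) := by
  simp only [trialAlg, QueryAlg.queries_ask, flagged_restrictTo, List.length_append,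
    length_seedPoints]
  by_cases h : Flagged f i s
  · simp only [h, if_true, length_queries_scanAlg]
    ring
  · simp [h, QueryAlg.queries]

lemma FirstSatisfies.exists {Ω : Type*} {q p : Ω → Prop} :
    ∀ {l : List Ω}, FirstSatisfies q p l → ∃ s, p s
  | _ :: _, Or.inl h => ⟨_, h.2⟩
  | _ :: _, Or.inr h => h.2.exists

lemma run_trialAlg_of_mem_unate {f : Hypergrid n d → ℝ} (hf : f ∈ Unate n d) (i : Fin d)
    (s : Seed n d K) (l : List (Seed n d K)) : (trialAlg i s l).run f = true := by
  rw [← Bool.not_eq_false, run_trialAlg]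
  rintro ⟨-, h⟩
  obtain ⟨t, h1 | h1, h2 | h2⟩ := h.exists <;>
  exact not_hasIncrease_of_hasDecrease hf h1 h2

/-- The randomness of one trial: the direction, the first sample, and the tape of samples that
are read if the first one is nonconstant. -/
abbrev TrialSeed (n d K M : ℕ) : Type := Fin d × Seed n d K × (Fin M → Seed n d K)

/-- The adaptive tester: `N` independent trials, cut off after `12 N` samples. -/
noncomputable def adaptiveAlg (N M : ℕ) (ω : Fin N → TrialSeed n d K M) :
    QueryAlg (Hypergrid n d) :=
  (QueryAlg.all (List.ofFn fun j => trialAlg (ω j).1 (ω j).2.1 (List.ofFn (ω j).2.2))).truncate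
    ((K + 3) * (12 * N))

lemma run_adaptiveAlg_of_mem_unate {f : Hypergrid n d → ℝ} (hf : f ∈ Unate n d) {N M : ℕ}
    (ω : Fin N → TrialSeed n d K M) : (adaptiveAlg N M ω).run f = true := by
  refine QueryAlg.run_truncate_of_run f _ _ ?_
  rw [← Bool.not_eq_false, QueryAlg.run_all_eq_false_iff]
  rintro ⟨T, hT, h⟩
  obtain ⟨j, rfl⟩ := (List.mem_ofFn' _ _).1 hT
  simp only [run_trialAlg_of_mem_unate hf, Bool.true_eq_false] at h

/-- The number of samples that a trial reads on input `f`. -/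
noncomputable def trialCost {M : ℕ} (f : Hypergrid n d → ℝ) (ω : TrialSeed n d K M) : ℕ :=
  1 + if Flagged f ω.1 ω.2.1 then waitingTime (Flagged f ω.1) (List.ofFn ω.2.2) else 0

lemma run_adaptiveAlg_eq_false {f : Hypergrid n d → ℝ} {N M : ℕ}
    {ω : Fin N → TrialSeed n d K M} (hcost : ∑ j, trialCost f (ω j) ≤ 12 * N) {j : Fin N}
    (hj : (trialAlg (ω j).1 (ω j).2.1 (List.ofFn (ω j).2.2)).run f = false) :
    (adaptiveAlg N M ω).run f = false := by
  rw [adaptiveAlg, QueryAlg.run_truncate_of_le]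
  · rw [QueryAlg.run_all_eq_false_iff]
    exact ⟨_, (List.mem_ofFn' _ _).2 ⟨j, rfl⟩, hj⟩
  · refine (QueryAlg.length_queries_all_le f _).trans ?_
    rw [List.map_ofFn, List.sum_ofFn]
    simp only [Function.comp_def, length_queries_trialAlg]
    rw [← Finset.mul_sum]
    exact Nat.mul_le_mul_left _ hcost

lemma expect_trialCost_le [Nonempty (Fin d)] [Nonempty (Fin n)] (f : Hypergrid n d → ℝ) (M : ℕ) :
    𝔼 ω : TrialSeed n d K M, (trialCost f ω : ℝ) ≤ 2 := by
  rw [expect_prod]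
  refine Finset.expect_le Finset.univ_nonempty fun i _ => ?_
  refine le_trans (le_of_eq ?_) (expect_trial_cost_le (Flagged (K := K) f i) M)
  refine Finset.expect_congr rfl fun x _ => ?_
  simp only [trialCost]
  push_cast
  rfl

lemma expect_fin_eq (g : Fin d → ℝ) : 𝔼 i, g i = (∑ i, g i) / d := by
  rw [Fintype.expect_eq_sum_div_card, Fintype.card_fin]

/-- A single trial rejects functions far from unate with probability of order `ε / d`. A tape of
length `M` suffices: the directions with a smaller probability than `1 / M` contribute at most
half of the lower bound of `le_sum_min_prob_sees`. -/
lemma le_prob_trialAlg_reject {f : Hypergrid n d → ℝ} {ε : ℝ} {M : ℕ} (hn : 1 ≤ n) (hd : 1 ≤ d)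
    (hK : n ≤ 2 ^ K) (hε : 0 < ε) (hf : IsFar (Unate n d) ε f) (hM : 192 * (d / ε) ≤ M) :
    ε / (768 * d) ≤ prob fun ω : TrialSeed n d K M =>
      (trialAlg ω.1 ω.2.1 (List.ofFn ω.2.2)).run f = false := by
  have : Nonempty (Fin n) := ⟨⟨0, hn⟩⟩
  have hd' : (0 : ℝ) < d := by exact_mod_cast hd
  have hM' : (0 : ℝ) < M := lt_of_lt_of_le (by positivity) hM
  have h1 := le_sum_min_prob_sees hn hK hf
  have h2 : ∀ i : Fin d, (min (prob (SeesDecrease (K := K) f i)) (prob (SeesIncrease (K := K) f i))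
      - ε / (192 * d)) / 4 ≤ prob fun x : Seed n d K × (Fin M → Seed n d K) =>
      (trialAlg i x.1 (List.ofFn x.2)).run f = false := by
    intro i
    set m := min (prob (SeesDecrease (K := K) f i)) (prob (SeesIncrease (K := K) f i))
    by_cases hm : 1 ≤ M * m
    · have := le_prob_both_marks _ _ hm
      simp only [run_trialAlg]
      have h3 : 0 ≤ ε / (192 * d) := by positivity
      refine le_trans ?_ this
      linarith
    · refine le_trans ?_ (prob_nonneg _)
      have h3 : m ≤ 1 / M := by
        rw [le_div_iff₀ hM']
        linarith
      have h4 : 1 / (M : ℝ) ≤ ε / (192 * d) := by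
        rw [div_le_div_iff₀ hM' (by positivity)]
        rw [← mul_div_assoc, div_le_iff₀ hε] at hM
        linarith
      linarith
  rw [prob_prod, expect_fin_eq, le_div_iff₀ hd']
  refine le_trans ?_ (Finset.sum_le_sum fun i _ => h2 i)
  rw [← Finset.sum_div, Finset.sum_sub_distrib, Finset.sum_const, Finset.card_univ,
    Fintype.card_fin, nsmul_eq_mul]
  have e1 : ε / (768 * d) * d = ε / 768 := by field_simp
  have e2 : (d : ℝ) * (ε / (192 * d)) = ε / 192 := by field_simp
  rw [e1, e2]
  linarith

/-- Either no trial rejects or the cutoff interferes in a failing run; each of the two events has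
probability at most `1 / 6`. -/
lemma le_prob_adaptiveAlg_reject {f : Hypergrid n d → ℝ} {ε : ℝ} {M N : ℕ} (hn : 1 ≤ n)
    (hd : 1 ≤ d) (hK : n ≤ 2 ^ K) (hε : 0 < ε) (hf : IsFar (Unate n d) ε f)
    (hM : 192 * (d / ε) ≤ M) (hN : 1536 * (d / ε) ≤ N) :
    2 / 3 ≤ prob fun ω : Fin N → TrialSeed n d K M => (adaptiveAlg N M ω).run f = false := by
  have : Nonempty (Fin n) := ⟨⟨0, hn⟩⟩
  have : Nonempty (Fin d) := ⟨⟨0, hd⟩⟩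
  have hd' : (0 : ℝ) < d := by exact_mod_cast hd
  have hN' : (0 : ℝ) < N := lt_of_lt_of_le (by positivity) hN
  set R : TrialSeed n d K M → Prop := fun ω =>
    (trialAlg ω.1 ω.2.1 (List.ofFn ω.2.2)).run f = false with hR
  have hδ : ε / (768 * d) ≤ prob R := le_prob_trialAlg_reject hn hd hK hε hf hM
  have hnone : prob (fun ω : Fin N → TrialSeed n d K M => ∀ j, ¬ R (ω j)) ≤ 1 / 6 := by
    rw [prob_forall fun _ ω => ¬ R ω, Finset.prod_const, Finset.card_univ, Fintype.card_fin,
      prob_not]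
    refine (one_sub_pow_le_exp (prob_le_one _) N).trans (le_trans ?_ exp_neg_two_lt_sixth.le)
    rw [Real.exp_le_exp, neg_le_neg_iff]
    calc (2 : ℝ) = 1536 * (d / ε) * (ε / (768 * d)) := by field_simp; norm_num
      _ ≤ N * prob R := mul_le_mul hN hδ (by positivity) hN'.le
  have hcost : prob (fun ω : Fin N → TrialSeed n d K M =>
      (12 * N : ℝ) < ∑ j, (trialCost f (ω j) : ℝ)) ≤ 1 / 6 := by
    refine (prob_lt_le (fun ω => by positivity) (by positivity)).trans ?_
    rw [div_le_iff₀ (by positivity), Finset.expect_sum_comm]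
    calc ∑ j : Fin N, 𝔼 ω : Fin N → TrialSeed n d K M, (trialCost f (ω j) : ℝ)
        ≤ ∑ _j : Fin N, (2 : ℝ) := Finset.sum_le_sum fun j _ => by
          rw [expect_pi_apply j fun x : TrialSeed n d K M => (trialCost f x : ℝ)]
          exact expect_trialCost_le f M
      _ = 1 / 6 * (12 * N) := by simp; ring
  have hunion : prob (fun ω : Fin N → TrialSeed n d K M => ¬ (adaptiveAlg N M ω).run f = false) ≤
      1 / 6 + 1 / 6 := by
    refine le_trans (prob_mono fun ω hω => ?_) ((prob_or_le _ _).trans (add_le_add hnone hcost))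
    by_contra hcon
    simp only [not_or, not_forall, not_not, not_lt] at hcon
    obtain ⟨⟨j, hj⟩, hc⟩ := hcon
    exact hω (run_adaptiveAlg_eq_false (by exact_mod_cast hc) hj)
  rw [prob_not] at hunion
  linarith

/-- For `n ≥ 2` there is an adaptive tester with `O(d log n / ε)` queries. -/
theorem exists_adaptive_tester {n d : ℕ} {ε : ℝ} (hn : 2 ≤ n) (hd : 1 ≤ d) (hε : 0 < ε)
    (hε2 : ε < 1 / 2) : ∃ A : RandAlg (Hypergrid n d), IsTester (Unate n d) ε A ∧
      HasOneSidedError (Unate n d) A ∧ MakesAtMost A (150000 * (d * Real.log n / ε)) := by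
  have : Nonempty (Fin n) := ⟨⟨0, by omega⟩⟩
  have : Nonempty (Fin d) := ⟨⟨0, hd⟩⟩
  set K := Nat.log 2 n + 1 with hKdef
  have hK : n ≤ 2 ^ K := (Nat.lt_pow_succ_log_self (by norm_num) n).le
  set M := ⌈192 * (d / ε)⌉₊
  set N := ⌈1536 * (d / ε)⌉₊ with hNdef
  obtain ⟨h1, h2⟩ := isTester_ofSeed (P := Unate n d) (ε := ε)
    (T := fun ω : Fin N → TrialSeed n d K M => adaptiveAlg N M ω)
    (fun f hf ω => run_adaptiveAlg_of_mem_unate hf ω)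
    (fun f hf => le_prob_adaptiveAlg_reject (by omega) hd hK hε hf (Nat.le_ceil _) (Nat.le_ceil _))
  refine ⟨_, h1, h2, ?_⟩
  intro T hT f
  obtain ⟨ω, rfl⟩ := mem_support_ofSeed.1 hT
  have hq : (((adaptiveAlg N M ω).queries f).length : ℝ) ≤ (K + 3) * (12 * N) := by
    exact_mod_cast QueryAlg.length_queries_truncate_le f _ _
  refine hq.trans ?_
  have hd' : (1 : ℝ) ≤ d := by exact_mod_cast hd
  have hdε : 1 ≤ d / ε := by rw [le_div_iff₀ hε]; linarith
  have hN : (N : ℝ) ≤ 1537 * (d / ε) := by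
    have := Nat.ceil_lt_add_one (a := 1536 * ((d : ℝ) / ε)) (by positivity)
    rw [← hNdef] at this
    linarith
  have hlog2 : 0.6931 < Real.log 2 := by linarith [Real.log_two_gt_d9]
  have hlogn : Real.log 2 ≤ Real.log n := Real.log_le_log (by norm_num) (by exact_mod_cast hn)
  have hKlog : (K : ℝ) + 3 ≤ 8 * Real.log n := by
    have h3 : (Nat.log 2 n : ℝ) * Real.log 2 ≤ Real.log n := by
      rw [← Real.log_pow]
      refine Real.log_le_log (by positivity) ?_
      exact_mod_cast Nat.pow_log_le_self 2 (by omega)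
    rw [hKdef]
    push_cast
    nlinarith [Nat.cast_nonneg (α := ℝ) (Nat.log 2 n)]
  calc ((K : ℝ) + 3) * (12 * N) ≤ (8 * Real.log n) * (12 * (1537 * (d / ε))) :=
        mul_le_mul hKlog (by linarith) (by positivity) (by linarith)
    _ = 147552 * (d * Real.log n / ε) := by ring
    _ ≤ 150000 * (d * Real.log n / ε) := by
        refine mul_le_mul_of_nonneg_right (by norm_num) ?_
        have : 0 ≤ Real.log n := by linarith
        positivity

end AdaptiveTester
/-! ### The nonadaptive tester -/

section NonadaptiveTester

open scoped Classical BigOperators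

variable {n d K : ℕ}

/-- Two points of `l` on a line of direction `i` form a decrease of `f`. -/
def DecreaseIn (f : Hypergrid n d → ℝ) (i : Fin d) (l : List (Hypergrid n d)) : Prop :=
  ∃ x ∈ l, ∃ c, Function.update x i c ∈ l ∧ x i < c ∧ f (Function.update x i c) < f x

/-- Two points of `l` on a line of direction `i` form an increase of `f`. -/
def IncreaseIn (f : Hypergrid n d → ℝ) (i : Fin d) (l : List (Hypergrid n d)) : Prop :=
  ∃ x ∈ l, ∃ c, Function.update x i c ∈ l ∧ x i < c ∧ f x < f (Function.update x i c)

lemma decreaseIn_restrictTo (f : Hypergrid n d → ℝ) (i : Fin d) (l : List (Hypergrid n d)) :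
    DecreaseIn (restrictTo l f) i l ↔ DecreaseIn f i l := by
  unfold DecreaseIn restrictTo
  refine exists_congr fun x => and_congr_right fun hx => exists_congr fun c =>
    and_congr_right fun hc => ?_
  rw [if_pos hx, if_pos hc]

lemma increaseIn_restrictTo (f : Hypergrid n d → ℝ) (i : Fin d) (l : List (Hypergrid n d)) :
    IncreaseIn (restrictTo l f) i l ↔ IncreaseIn f i l := by
  unfold IncreaseIn restrictTo
  refine exists_congr fun x => and_congr_right fun hx => exists_congr fun c =>
    and_congr_right fun hc => ?_
  rw [if_pos hx, if_pos hc]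

lemma decreaseIn_of_hasDecrease {f : Hypergrid n d → ℝ} {i : Fin d} {x : Hypergrid n d}
    {Q : List (Fin n)} {l : List (Hypergrid n d)} (h : HasDecrease (lineFn f i x) Q)
    (hQ : ∀ a ∈ Q, Function.update x i a ∈ l) : DecreaseIn f i l := by
  obtain ⟨a, ha, b, hb, hab, hf⟩ := h
  exact ⟨_, hQ a ha, b, by simpa using hQ b hb, by simpa using hab, by simpa [lineFn] using hf⟩

lemma increaseIn_of_hasIncrease {f : Hypergrid n d → ℝ} {i : Fin d} {x : Hypergrid n d}
    {Q : List (Fin n)} {l : List (Hypergrid n d)} (h : HasIncrease (lineFn f i x) Q)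
    (hQ : ∀ a ∈ Q, Function.update x i a ∈ l) : IncreaseIn f i l := by
  obtain ⟨a, ha, b, hb, hab, hf⟩ := h
  exact ⟨_, hQ a ha, b, by simpa using hQ b hb, by simpa using hab, by simpa [lineFn] using hf⟩

/-- Query all points of `l`, and reject if the answers prove that the function is not unate. -/
noncomputable def refuteAlg (l : List (Hypergrid n d)) : QueryAlg (Hypergrid n d) :=
  .ask l fun g => .output (decide ¬ ∃ i, DecreaseIn g i l ∧ IncreaseIn g i l)

lemma run_refuteAlg (l : List (Hypergrid n d)) (f : Hypergrid n d → ℝ) :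
    (refuteAlg l).run f = false ↔ ∃ i, DecreaseIn f i l ∧ IncreaseIn f i l := by
  simp only [refuteAlg, QueryAlg.run_ask, QueryAlg.run, decreaseIn_restrictTo,
    increaseIn_restrictTo, decide_eq_false_iff_not, not_not]

lemma queries_refuteAlg (l : List (Hypergrid n d)) (f : Hypergrid n d → ℝ) :
    (refuteAlg l).queries f = l := by
  simp [refuteAlg, QueryAlg.queries_ask, QueryAlg.queries]

lemma run_refuteAlg_of_mem_unate {f : Hypergrid n d → ℝ} (hf : f ∈ Unate n d)
    (l : List (Hypergrid n d)) : (refuteAlg l).run f = true := by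
  rw [← Bool.not_eq_false, run_refuteAlg]
  rintro ⟨i, ⟨x, -, c, -, hc, h⟩, ⟨x', -, c', -, hc', h'⟩⟩
  refine not_hasIncrease_of_hasDecrease (i := i) (x := x) (y := x') (Q := [x i, c])
    (Q' := [x' i, c']) hf ?_ ?_
  · exact ⟨x i, by simp, c, by simp, hc, by simpa [lineFn] using h⟩
  · exact ⟨x' i, by simp, c', by simp, hc', by simpa [lineFn] using h'⟩

/-- The randomness of the nonadaptive tester: `N` line samples in random directions, and, for every
level `r < R`, `s r` rounds, each consisting of a random direction and `2 ^ r` pairs of points of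
random lines of that direction. -/
abbrev NonadaptiveSeed (n d K N R : ℕ) (s : ℕ → ℕ) : Type :=
  (Fin N → Fin d × Seed n d K) ×
    (∀ j : (r : Fin R) × Fin (s r), Fin d × (Fin (2 ^ (j.1 : ℕ)) → Hypergrid n d × Fin n))

/-- The points queried by the nonadaptive tester. -/
noncomputable def nonadaptivePoints {N R : ℕ} {s : ℕ → ℕ} (ω : NonadaptiveSeed n d K N R s) :
    List (Hypergrid n d) :=
  (Finset.univ.toList.flatMap fun j : Fin N => seedPoints (ω.1 j).1 (ω.1 j).2) ++
  Finset.univ.toList.flatMap fun j : (r : Fin R) × Fin (s r) =>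
    Finset.univ.toList.flatMap fun t : Fin (2 ^ (j.1 : ℕ)) =>
      [((ω.2 j).2 t).1, Function.update ((ω.2 j).2 t).1 (ω.2 j).1 ((ω.2 j).2 t).2]

lemma length_nonadaptivePoints {N R : ℕ} {s : ℕ → ℕ} (ω : NonadaptiveSeed n d K N R s) :
    (nonadaptivePoints ω).length = N * (K + 3) + ∑ r ∈ Finset.range R, s r * (2 ^ r * 2) := by
  simp only [nonadaptivePoints, List.length_append, List.length_flatMap, length_seedPoints,
    Finset.sum_map_toList, Finset.sum_const, Finset.card_univ, Fintype.card_fin, smul_eq_mul,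
    List.length_cons, List.length_nil]
  congr 1
  rw [Fintype.sum_sigma, ← Fin.sum_univ_eq_sum_range fun r => s r * (2 ^ r * 2)]
  simp

lemma run_refuteAlg_of_sees {f : Hypergrid n d → ℝ} {N R : ℕ} {s : ℕ → ℕ}
    {ω : NonadaptiveSeed n d K N R s} {j : Fin N}
    (h : SeesDecrease f (ω.1 j).1 (ω.1 j).2 ∧ SeesIncrease f (ω.1 j).1 (ω.1 j).2) :
    (refuteAlg (nonadaptivePoints ω)).run f = false := by
  have hmem : ∀ a ∈ lineSample K ((ω.1 j).2.1 (ω.1 j).1) (ω.1 j).2.2.1 (ω.1 j).2.2.2,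
      Function.update (ω.1 j).2.1 (ω.1 j).1 a ∈ nonadaptivePoints ω := by
    intro a ha
    refine List.mem_append_left _ (List.mem_flatMap.2 ⟨j, by simp, ?_⟩)
    exact List.mem_map.2 ⟨a, ha, rfl⟩
  exact (run_refuteAlg _ _).2 ⟨_, decreaseIn_of_hasDecrease h.1 hmem,
    increaseIn_of_hasIncrease h.2 hmem⟩

lemma run_refuteAlg_of_pairs {f : Hypergrid n d → ℝ} {N R : ℕ} {s : ℕ → ℕ}
    {ω : NonadaptiveSeed n d K N R s} {j : (r : Fin R) × Fin (s r)}
    (h : (∃ t, PairDecrease f (ω.2 j).1 ((ω.2 j).2 t)) ∧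
      ∃ t, PairIncrease f (ω.2 j).1 ((ω.2 j).2 t)) :
    (refuteAlg (nonadaptivePoints ω)).run f = false := by
  have hmem : ∀ t, ∀ a ∈ [((ω.2 j).2 t).1 (ω.2 j).1, ((ω.2 j).2 t).2],
      Function.update ((ω.2 j).2 t).1 (ω.2 j).1 a ∈ nonadaptivePoints ω := by
    intro t a ha
    refine List.mem_append_right _ (List.mem_flatMap.2 ⟨j, by simp, ?_⟩)
    refine List.mem_flatMap.2 ⟨t, by simp, ?_⟩
    simp only [List.mem_cons, List.not_mem_nil, or_false] at ha ⊢
    rcases ha with rfl | rfl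
    · exact Or.inl (Function.update_eq_self _ _)
    · exact Or.inr rfl
  obtain ⟨⟨t, ht⟩, ⟨t', ht'⟩⟩ := h
  exact (run_refuteAlg _ _).2 ⟨_, decreaseIn_of_hasDecrease ht (hmem t),
    increaseIn_of_hasIncrease ht' (hmem t')⟩

/-- If two events have probability at least `1 / m` each, then both are seen among `m` independent
samples with probability at least `1 / 4`. -/
lemma quarter_le_prob_exists_and_exists {Ω : Type*} [Fintype Ω] [Nonempty Ω] (D U : Ω → Prop)
    {m : ℕ} (h : 1 ≤ m * min (prob D) (prob U)) :
    1 / 4 ≤ prob fun t : Fin m → Ω => (∃ a, D (t a)) ∧ ∃ a, U (t a) := by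
  have key : ∀ p : Ω → Prop, min (prob D) (prob U) ≤ prob p →
      prob (fun t : Fin m → Ω => ∀ a, ¬ p (t a)) ≤ 3 / 8 := by
    intro p hp
    rw [prob_forall fun _ ω => ¬ p ω, Finset.prod_const, Finset.card_univ, Fintype.card_fin,
      prob_not]
    refine (one_sub_pow_le_exp (prob_le_one _) m).trans (le_trans ?_ exp_neg_one_le)
    rw [Real.exp_le_exp, neg_le_neg_iff]
    exact h.trans (mul_le_mul_of_nonneg_left hp (by positivity))
  have hunion : prob (fun t : Fin m → Ω => ¬ ((∃ a, D (t a)) ∧ ∃ a, U (t a))) ≤ 3 / 8 + 3 / 8 := by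
    refine le_trans (prob_mono fun t ht => ?_) ((prob_or_le _ _).trans
      (add_le_add (key D (min_le_left _ _)) (key U (min_le_right _ _))))
    rwa [not_and_or, not_exists, not_exists] at ht
  rw [prob_not] at hunion
  linarith

/-- The dyadic levels at which `a` is visible have total weight of order `a`, unless `a` is below
the resolution `2 ^ (1 - R)`. -/
lemma half_le_sum_levels {a : ℝ} (ha : a ≤ 1) (R : ℕ) :
    (a - 2 / 2 ^ R) / 2 ≤ ∑ r ∈ Finset.range R, if 1 ≤ 2 ^ r * a then 1 / (2 : ℝ) ^ r else 0 := by
  have hnonneg : ∀ r ∈ Finset.range R,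
      (0 : ℝ) ≤ if 1 ≤ 2 ^ r * a then 1 / (2 : ℝ) ^ r else 0 := by
    intro r _
    split_ifs <;> positivity
  by_cases hsmall : a < 2 / 2 ^ R
  · refine le_trans ?_ (Finset.sum_nonneg hnonneg)
    linarith
  have hex : ∃ r : ℕ, r + 1 ≤ R ∧ 1 ≤ 2 ^ r * a := by
    rcases Nat.eq_zero_or_pos R with rfl | hR
    · norm_num at hsmall
      linarith
    · refine ⟨R - 1, by omega, ?_⟩
      rw [not_lt, div_le_iff₀ (by positivity)] at hsmall
      have : (2 : ℝ) ^ R = 2 * 2 ^ (R - 1) := by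
        rw [← pow_succ', Nat.sub_add_cancel hR]
      rw [this] at hsmall
      linarith
  have hr := Nat.find_spec hex
  set r := Nat.find hex with hrdef
  have hterm : a / 2 ≤ 1 / (2 : ℝ) ^ r := by
    rcases Nat.eq_zero_or_pos r with h0 | h0
    · rw [h0, pow_zero]
      linarith
    · have := Nat.find_min hex (m := r - 1) (by omega)
      rw [not_and, not_le] at this
      have := this (by omega)
      rw [le_div_iff₀ (by positivity)]
      have h2 : (2 : ℝ) ^ r = 2 * 2 ^ (r - 1) := by
        rw [← pow_succ', Nat.sub_add_cancel h0]
      rw [h2]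
      linarith
  have hle := Finset.single_le_sum hnonneg (Finset.mem_range.2 hr.1)
  rw [if_pos hr.2] at hle
  have : (0 : ℝ) ≤ 2 / 2 ^ R := by positivity
  linarith

/-- The rounds with pairs, organised by levels, detect a function for which the sum over the
directions of the smaller of the two pair probabilities is large: directions with probability
`2 ^ (-r)` are found by the rounds of level `r`. -/
lemma prob_pairs_fail_le {f : Hypergrid n d → ℝ} (hn : 1 ≤ n) (hd : 1 ≤ d) {R : ℕ} {s : ℕ → ℕ}
    {S : ℝ} (hs : ∀ r, S / 2 ^ r ≤ s r) (hS0 : 0 ≤ S)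
    (hS : 2 ≤ S / (8 * d) * (∑ i, min (prob (PairDecrease f i)) (prob (PairIncrease f i)) -
      d * (2 / 2 ^ R))) :
    prob (fun ω : ∀ j : (r : Fin R) × Fin (s r),
      Fin d × (Fin (2 ^ (j.1 : ℕ)) → Hypergrid n d × Fin n) => ∀ j,
        ¬ ((∃ t, PairDecrease f (ω j).1 ((ω j).2 t)) ∧
          ∃ t, PairIncrease f (ω j).1 ((ω j).2 t))) ≤ 1 / 6 := by
  have : Nonempty (Fin n) := ⟨⟨0, hn⟩⟩
  have : Nonempty (Fin d) := ⟨⟨0, hd⟩⟩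
  have hd' : (0 : ℝ) < d := by exact_mod_cast hd
  set a : Fin d → ℝ := fun i => min (prob (PairDecrease f i)) (prob (PairIncrease f i)) with ha
  let G : ∀ r : ℕ, Fin d × (Fin (2 ^ r) → Hypergrid n d × Fin n) → Prop := fun r x =>
    (∃ t, PairDecrease f x.1 (x.2 t)) ∧ ∃ t, PairIncrease f x.1 (x.2 t)
  have hG : ∀ r : ℕ, (∑ i, if 1 ≤ 2 ^ r * a i then (1 : ℝ) else 0) / (4 * d) ≤ prob (G r) := by
    intro r
    rw [prob_prod, expect_fin_eq, div_le_div_iff₀ (by positivity) hd', Finset.sum_mul,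
      Finset.sum_mul]
    refine Finset.sum_le_sum fun i _ => ?_
    split_ifs with h
    · have := quarter_le_prob_exists_and_exists (PairDecrease f i) (PairIncrease f i)
        (m := 2 ^ r) (by exact_mod_cast h)
      have := mul_le_mul_of_nonneg_right this (show (0 : ℝ) ≤ 4 * d by positivity)
      linarith
    · have := prob_nonneg fun b => G r (i, b)
      rw [zero_mul]
      positivity
  rw [prob_forall fun (j : (r : Fin R) × Fin (s r)) x => ¬ G j.1 x]
  simp only [prob_not]
  have hprod : ∏ j : (r : Fin R) × Fin (s r), (1 - prob (G j.1)) =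
      ∏ r ∈ Finset.range R, (1 - prob (G r)) ^ s r := by
    rw [Fintype.prod_sigma, ← Fin.prod_univ_eq_prod_range fun r => (1 - prob (G r)) ^ s r]
    exact Finset.prod_congr rfl fun r _ => Fin.prod_const (s r) (1 - prob (G r))
  refine hprod.le.trans ?_
  calc ∏ r ∈ Finset.range R, (1 - prob (G r)) ^ s r
      ≤ ∏ r ∈ Finset.range R, Real.exp (-(s r * prob (G r))) :=
        Finset.prod_le_prod (fun r _ => pow_nonneg (by linarith [prob_le_one (G r)]) _)
          fun r _ => one_sub_pow_le_exp (prob_le_one _) _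
    _ = Real.exp (∑ r ∈ Finset.range R, -(s r * prob (G r))) := (Real.exp_sum _ _).symm
    _ ≤ Real.exp (-2) := by
        rw [Real.exp_le_exp, Finset.sum_neg_distrib, neg_le_neg_iff]
        refine hS.trans ?_
        have h1 : S / (8 * d) * (∑ i, a i - d * (2 / 2 ^ R)) =
            S / (4 * d) * ∑ i, (a i - 2 / 2 ^ R) / 2 := by
          rw [← Finset.sum_div, Finset.sum_sub_distrib, Finset.sum_const, Finset.card_univ,
            Fintype.card_fin, nsmul_eq_mul]
          ring
        rw [h1]
        calc S / (4 * d) * ∑ i, (a i - 2 / 2 ^ R) / 2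
            ≤ S / (4 * d) * ∑ i, ∑ r ∈ Finset.range R,
                (if 1 ≤ 2 ^ r * a i then 1 / (2 : ℝ) ^ r else 0) :=
              mul_le_mul_of_nonneg_left (Finset.sum_le_sum fun i _ => half_le_sum_levels
                ((min_le_left _ _).trans (prob_le_one _)) R) (by positivity)
          _ = ∑ r ∈ Finset.range R, S / 2 ^ r *
                ((∑ i, if 1 ≤ 2 ^ r * a i then (1 : ℝ) else 0) / (4 * d)) := by
              rw [Finset.sum_comm, Finset.mul_sum]
              refine Finset.sum_congr rfl fun r _ => ?_
              have : (∑ i, if 1 ≤ 2 ^ r * a i then 1 / (2 : ℝ) ^ r else 0) =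
                  1 / 2 ^ r * ∑ i, if 1 ≤ 2 ^ r * a i then (1 : ℝ) else 0 := by
                rw [Finset.mul_sum]
                refine Finset.sum_congr rfl fun i _ => ?_
                split_ifs <;> simp
              rw [this]
              ring
          _ ≤ ∑ r ∈ Finset.range R, s r * prob (G r) := by
              refine Finset.sum_le_sum fun r _ => mul_le_mul (hs r) (hG r) ?_ (by positivity)
              refine div_nonneg (Finset.sum_nonneg fun i _ => ?_) (by positivity)
              split_ifs <;> norm_num
    _ ≤ 1 / 6 := exp_neg_two_lt_sixth.le

/-- By `le_sum_min_prob_pair`, one of the two phases of the nonadaptive tester fails with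
probability at most `1 / 6`. -/
lemma le_prob_refuteAlg_reject {f : Hypergrid n d → ℝ} {ε : ℝ} {N R : ℕ} {s : ℕ → ℕ} (hn : 1 ≤ n)
    (hd : 1 ≤ d) (hK : n ≤ 2 ^ K) (hε : 0 < ε) (hf : IsFar (Unate n d) ε f)
    (hN : 1536 * (d / ε) ≤ N) (hR : 50688 * (d / ε) ≤ 2 ^ R)
    (hs : ∀ r, 405504 * (d / ε) / 2 ^ r ≤ s r) :
    2 / 3 ≤ prob fun ω : NonadaptiveSeed n d K N R s =>
      (refuteAlg (nonadaptivePoints ω)).run f = false := by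
  have : Nonempty (Fin n) := ⟨⟨0, hn⟩⟩
  have : Nonempty (Fin d) := ⟨⟨0, hd⟩⟩
  have hd' : (0 : ℝ) < d := by exact_mod_cast hd
  have hN' : (0 : ℝ) < N := lt_of_lt_of_le (by positivity) hN
  have h := le_sum_min_prob_pair hn hK hf
  set t := ∑ i, prob (fun s : Seed n d K => SeesDecrease f i s ∧ SeesIncrease f i s) with ht
  set a := ∑ i, min (prob (PairDecrease f i)) (prob (PairIncrease f i)) with ha
  suffices hfail : prob (fun ω : NonadaptiveSeed n d K N R s =>
      ¬ (refuteAlg (nonadaptivePoints ω)).run f = false) ≤ 1 / 6 by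
    rw [prob_not] at hfail
    linarith
  by_cases hcase : ε / 768 ≤ t
  · -- single line samples suffice
    set P : Fin d × Seed n d K → Prop := fun x => SeesDecrease f x.1 x.2 ∧ SeesIncrease f x.1 x.2
      with hP
    have hδ : ε / (768 * d) ≤ prob P := by
      rw [prob_prod, expect_fin_eq, ← div_div]
      exact div_le_div_of_nonneg_right hcase hd'.le
    have hmono : prob (fun ω : NonadaptiveSeed n d K N R s =>
        ¬ (refuteAlg (nonadaptivePoints ω)).run f = false) ≤
        prob (fun ω : NonadaptiveSeed n d K N R s => ∀ j, ¬ P (ω.1 j)) :=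
      prob_mono fun ω hω j hj => hω (run_refuteAlg_of_sees hj)
    refine hmono.trans ?_
    rw [prob_fst (fun u : Fin N → Fin d × Seed n d K => ∀ j, ¬ P (u j)),
      prob_forall fun _ ω => ¬ P ω, Finset.prod_const, Finset.card_univ, Fintype.card_fin,
      prob_not]
    refine (one_sub_pow_le_exp (prob_le_one _) N).trans (le_trans ?_ exp_neg_two_lt_sixth.le)
    rw [Real.exp_le_exp, neg_le_neg_iff]
    calc (2 : ℝ) = 1536 * (d / ε) * (ε / (768 * d)) := by field_simp; norm_num
      _ ≤ N * prob P := mul_le_mul hN hδ (by positivity) hN'.le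
  · -- pairs of uniform points suffice
    have hmono : prob (fun ω : NonadaptiveSeed n d K N R s =>
        ¬ (refuteAlg (nonadaptivePoints ω)).run f = false) ≤
        prob (fun ω : NonadaptiveSeed n d K N R s => ∀ j,
          ¬ ((∃ t, PairDecrease f (ω.2 j).1 ((ω.2 j).2 t)) ∧
            ∃ t, PairIncrease f (ω.2 j).1 ((ω.2 j).2 t))) :=
      prob_mono fun ω hω j hj => hω (run_refuteAlg_of_pairs hj)
    refine hmono.trans ((prob_snd _).le.trans
      (prob_pairs_fail_le hn hd hs (by positivity) ?_))
    have ha' : ε / 12672 ≤ a := by linarith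
    have hR' : (d : ℝ) * (2 / 2 ^ R) ≤ ε / 25344 := by
      rw [← mul_div_assoc, div_le_div_iff₀ (by positivity) (by norm_num)]
      rw [← mul_div_assoc, div_le_iff₀ hε] at hR
      linarith
    calc (2 : ℝ) = 405504 * (d / ε) / (8 * d) * (ε / 25344) := by field_simp; norm_num
      _ ≤ 405504 * (d / ε) / (8 * d) * (a - d * (2 / 2 ^ R)) :=
        mul_le_mul_of_nonneg_left (by linarith) (by positivity)

/-- There is a nonadaptive tester with `O((d / ε) (log (d / ε) + log n))` queries. -/
theorem exists_nonadaptive_tester {n d : ℕ} {ε : ℝ} (hn : 1 ≤ n) (hd : 1 ≤ d) (hε : 0 < ε)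
    (hε2 : ε < 1 / 2) : ∃ A : RandAlg (Hypergrid n d), IsTester (Unate n d) ε A ∧
      HasOneSidedError (Unate n d) A ∧ IsNonadaptive A ∧
      MakesAtMost A (22000000 * ((d / ε) * (Real.log (d / ε) + Real.log n))) := by
  have : Nonempty (Fin n) := ⟨⟨0, hn⟩⟩
  have : Nonempty (Fin d) := ⟨⟨0, hd⟩⟩
  have hd' : (1 : ℝ) ≤ d := by exact_mod_cast hd
  set D : ℝ := d / ε with hD
  have hD2 : 2 ≤ D := by rw [hD, le_div_iff₀ hε]; linarith
  set K := Nat.log 2 n + 1 with hKdef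
  have hK : n ≤ 2 ^ K := (Nat.lt_pow_succ_log_self (by norm_num) n).le
  set N := ⌈1536 * D⌉₊ with hNdef
  set m := ⌈50688 * D⌉₊ with hmdef
  set R := Nat.log 2 m + 1 with hRdef
  set s : ℕ → ℕ := fun r => ⌈405504 * D / 2 ^ r⌉₊ with hsdef
  have hmR : (m : ℝ) ≤ 2 ^ R := by
    exact_mod_cast (Nat.lt_pow_succ_log_self (by norm_num) m).le
  obtain ⟨h1, h2⟩ := isTester_ofSeed (P := Unate n d) (ε := ε)
    (T := fun ω : NonadaptiveSeed n d K N R s => refuteAlg (nonadaptivePoints ω))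
    (fun f hf ω => run_refuteAlg_of_mem_unate hf _)
    (fun f hf => le_prob_refuteAlg_reject hn hd hK hε hf (Nat.le_ceil _)
      ((Nat.le_ceil _).trans hmR) fun r => Nat.le_ceil _)
  refine ⟨_, h1, h2, ?_, ?_⟩
  · intro T hT f g
    obtain ⟨ω, rfl⟩ := mem_support_ofSeed.1 hT
    rw [queries_refuteAlg, queries_refuteAlg]
  intro T hT f
  obtain ⟨ω, rfl⟩ := mem_support_ofSeed.1 hT
  rw [queries_refuteAlg, length_nonadaptivePoints]
  push_cast
  set L := Real.log D with hL
  have hlog2 : 0.6931 < Real.log 2 := by linarith [Real.log_two_gt_d9]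
  have hL2 : Real.log 2 ≤ L := Real.log_le_log (by norm_num) hD2
  have hn0 : 0 ≤ Real.log n := Real.log_natCast_nonneg n
  have hN : (N : ℝ) ≤ 1537 * D := by
    have := Nat.ceil_lt_add_one (a := 1536 * D) (by linarith)
    rw [← hNdef] at this
    linarith
  have hm : (m : ℝ) ≤ 50689 * D := by
    have := Nat.ceil_lt_add_one (a := 50688 * D) (by linarith)
    rw [← hmdef] at this
    linarith
  have hm0 : (0 : ℝ) < m := lt_of_lt_of_le (by linarith : (0 : ℝ) < 50688 * D) (Nat.le_ceil _)
  have hm0' : m ≠ 0 := by exact_mod_cast hm0.ne'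
  have hpowlog : ((2 : ℝ) ^ Nat.log 2 m) ≤ m := by exact_mod_cast Nat.pow_log_le_self 2 hm0'
  have h2R : (2 : ℝ) ^ R ≤ 101378 * D := by
    rw [hRdef, pow_succ]
    linarith
  have hRL : (R : ℝ) ≤ 26 * L := by
    have h3 : (R : ℝ) * Real.log 2 ≤ 18 * L := by
      rw [← Real.log_pow]
      calc Real.log (2 ^ R) ≤ Real.log (2 ^ 17 * D) :=
            Real.log_le_log (by positivity) (h2R.trans (by linarith))
        _ = 17 * Real.log 2 + L := by
            rw [Real.log_mul (by positivity) (by linarith), Real.log_pow, ← hL]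
            norm_num
        _ ≤ 18 * L := by linarith
    have h4 : (0 : ℝ) ≤ R := Nat.cast_nonneg R
    nlinarith
  have hKlog : (K : ℝ) + 3 ≤ 6 * (L + Real.log n) := by
    have h3 : (Nat.log 2 n : ℝ) * Real.log 2 ≤ Real.log n := by
      rw [← Real.log_pow]
      refine Real.log_le_log (by positivity) ?_
      exact_mod_cast Nat.pow_log_le_self 2 (by omega)
    rw [hKdef]
    push_cast
    nlinarith [Nat.cast_nonneg (α := ℝ) (Nat.log 2 n)]
  have hlevel : ∑ r ∈ Finset.range R, (s r : ℝ) * (2 ^ r * 2) ≤ 811008 * D * R + 2 * 2 ^ R := by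
    have h3 : ∀ r ∈ Finset.range R, (s r : ℝ) * (2 ^ r * 2) ≤ 811008 * D + 2 * 2 ^ r := by
      intro r _
      have h4 := Nat.ceil_lt_add_one (a := 405504 * D / 2 ^ r) (by positivity)
      have h5 : (s r : ℝ) ≤ 405504 * D / 2 ^ r + 1 := h4.le
      calc (s r : ℝ) * (2 ^ r * 2) ≤ (405504 * D / 2 ^ r + 1) * (2 ^ r * 2) :=
            mul_le_mul_of_nonneg_right h5 (by positivity)
        _ = 811008 * D + 2 * 2 ^ r := by field_simp; ring
    refine (Finset.sum_le_sum h3).trans ?_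
    rw [Finset.sum_add_distrib, ← Finset.mul_sum (f := fun r => (2 : ℝ) ^ r),
      geom_sum_eq (by norm_num), Finset.sum_const, Finset.card_range, nsmul_eq_mul]
    linarith
  have hDL : 0 ≤ D * L := mul_nonneg (by linarith) (by linarith)
  have hDn : 0 ≤ D * Real.log n := mul_nonneg (by linarith) hn0
  calc (N : ℝ) * (K + 3) + ∑ r ∈ Finset.range R, (s r : ℝ) * (2 ^ r * 2)
      ≤ 1537 * D * (6 * (L + Real.log n)) + (811008 * D * (26 * L) + 2 * (101378 * D)) := by
        refine add_le_add (mul_le_mul hN hKlog (by positivity) (by linarith)) (hlevel.trans ?_)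
        refine add_le_add (mul_le_mul_of_nonneg_left hRL (by linarith)) (by linarith)
    _ ≤ 22000000 * (D * (L + Real.log n)) := by
        have h6 : D * 0.6931 ≤ D * L := mul_le_mul_of_nonneg_left (by linarith) (by linarith)
        linarith

end NonadaptiveTester

/-! ### The line with one point -/

section Conclusion

/-- For `n = 1` all functions are unate, and no queries are needed. -/
lemma exists_trivial_tester (d : ℕ) {ε : ℝ} (hε : 0 < ε) :
    ∃ A : RandAlg (Hypergrid 1 d), IsTester (Unate 1 d) ε A ∧
      HasOneSidedError (Unate 1 d) A ∧ MakesAtMost A 0 := by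
  obtain ⟨h1, h2⟩ := isTester_ofSeed (P := Unate 1 d) (ε := ε)
    (T := fun _ : Unit => QueryAlg.output true) (fun _ _ _ => rfl) (fun f hf => by
      have h := hf f fun i => Or.inl fun x => Subsingleton.monotone _
      rw [hammingDist_self, Nat.cast_zero] at h
      have : (0 : ℝ) < Fintype.card (Hypergrid 1 d) := by exact_mod_cast Fintype.card_pos
      exact absurd h (not_le.2 (by positivity)))
  refine ⟨_, h1, h2, ?_⟩
  intro T hT f
  obtain ⟨_, rfl⟩ := mem_support_ofSeed.1 hT
  simp [QueryAlg.queries]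

lemma MakesAtMost.mono {X : Type} {A : RandAlg X} {q q' : ℝ} (h : MakesAtMost A q) (hq : q ≤ q') :
    MakesAtMost A q' := fun T hT f => (h T hT f).trans hq

end Conclusion

end PropertyTesting

open PropertyTesting in
theorem theorem1 :
    (∃ C : ℝ, 0 < C ∧ ∃ A : (n d : ℕ) → (ε : ℝ) → RandAlg (Hypergrid n d),
      ∀ (n d : ℕ) (ε : ℝ), 1 ≤ n → 1 ≤ d → 0 < ε → ε < 1 / 2 →
        IsTester (Unate n d) ε (A n d ε) ∧
        HasOneSidedError (Unate n d) (A n d ε) ∧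
        IsNonadaptive (A n d ε) ∧
        MakesAtMost (A n d ε) (C * ((d / ε) * (Real.log (d / ε) + Real.log n))) ∧
        (n = 2 → MakesAtMost (A n d ε) (C * ((d / ε) * Real.log (d / ε))))) ∧
    (∃ C : ℝ, 0 < C ∧ ∃ A : (n d : ℕ) → (ε : ℝ) → RandAlg (Hypergrid n d),
      ∀ (n d : ℕ) (ε : ℝ), 1 ≤ n → 1 ≤ d → 0 < ε → ε < 1 / 2 →
        IsTester (Unate n d) ε (A n d ε) ∧
        HasOneSidedError (Unate n d) (A n d ε) ∧
        MakesAtMost (A n d ε) (C * (d * Real.log n / ε)) ∧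
        (n = 2 → MakesAtMost (A n d ε) (C * (d / ε)))) := by
  constructor
  · have hex : ∀ (n d : ℕ) (ε : ℝ), ∃ A : RandAlg (Hypergrid n d), 1 ≤ n → 1 ≤ d → 0 < ε →
        ε < 1 / 2 → IsTester (Unate n d) ε A ∧ HasOneSidedError (Unate n d) A ∧
          IsNonadaptive A ∧
          MakesAtMost A (22000000 * ((d / ε) * (Real.log (d / ε) + Real.log n))) := by
      intro n d ε
      by_cases h : 1 ≤ n ∧ 1 ≤ d ∧ 0 < ε ∧ ε < 1 / 2
      · obtain ⟨A, hA⟩ := exists_nonadaptive_tester h.1 h.2.1 h.2.2.1 h.2.2.2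
        exact ⟨A, fun _ _ _ _ => hA⟩
      · exact ⟨PMF.pure (.output true), fun h1 h2 h3 h4 => absurd ⟨h1, h2, h3, h4⟩ h⟩
    choose A hA using hex
    refine ⟨44000000, by norm_num, A, fun n d ε hn hd hε hε2 => ?_⟩
    obtain ⟨h1, h2, h3, h4⟩ := hA n d ε hn hd hε hε2
    have hd' : (1 : ℝ) ≤ d := by exact_mod_cast hd
    have hD2 : 2 ≤ d / ε := by rw [le_div_iff₀ hε]; linarith
    have hL : Real.log 2 ≤ Real.log (d / ε) := Real.log_le_log (by norm_num) hD2
    have hlog2 : 0 < Real.log 2 := Real.log_pos (by norm_num)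
    have hlogn : 0 ≤ Real.log n := Real.log_natCast_nonneg n
    refine ⟨h1, h2, h3, h4.mono ?_, fun hn2 => h4.mono ?_⟩
    · exact mul_le_mul_of_nonneg_right (by norm_num)
        (mul_nonneg (by linarith) (by linarith))
    · subst hn2
      have := mul_le_mul_of_nonneg_left hL (show 0 ≤ d / ε by linarith)
      push_cast
      linarith
  · have hex : ∀ (n d : ℕ) (ε : ℝ), ∃ A : RandAlg (Hypergrid n d), 1 ≤ n → 1 ≤ d → 0 < ε →
        ε < 1 / 2 → IsTester (Unate n d) ε A ∧ HasOneSidedError (Unate n d) A ∧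
          MakesAtMost A (150000 * (d * Real.log n / ε)) := by
      intro n d ε
      by_cases h : 2 ≤ n ∧ 1 ≤ d ∧ 0 < ε ∧ ε < 1 / 2
      · obtain ⟨A, hA⟩ := exists_adaptive_tester h.1 h.2.1 h.2.2.1 h.2.2.2
        exact ⟨A, fun _ _ _ _ => hA⟩
      · by_cases h' : n = 1 ∧ 0 < ε
        · obtain ⟨rfl, hε⟩ := h'
          obtain ⟨A, hA⟩ := exists_trivial_tester d hε
          exact ⟨A, fun _ _ _ _ => by simpa using hA⟩
        · exact ⟨PMF.pure (.output true), fun h1 h2 h3 h4 =>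
            absurd ⟨by by_contra hlt; exact h' ⟨by omega, h3⟩, h2, h3, h4⟩ h⟩
    choose A hA using hex
    refine ⟨150000, by norm_num, A, fun n d ε hn hd hε hε2 => ?_⟩
    obtain ⟨h1, h2, h3⟩ := hA n d ε hn hd hε hε2
    refine ⟨h1, h2, h3, fun hn2 => h3.mono ?_⟩
    subst hn2
    have hlog : Real.log 2 ≤ 1 := by linarith [Real.log_two_lt_d9]
    refine mul_le_mul_of_nonneg_left ?_ (by norm_num)
    refine div_le_div_of_nonneg_right ?_ hε.le
    exact mul_le_of_le_one_right (by positivity) (by exact_mod_cast hlog)
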